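/- Let $1\le N\le n$ be integers and $b>0$, with $b\neq 1$ unless $N=1$. Put $\Sigma=\mathrm{diag}(b,1,\dots,1)$ (size $N\times N$) and $c:=1-1/b$. Let $X$ be an $n\times N$ standard complex Gaussian matrix, i.e. with independent entries, each having density $\pi^{-1}e^{-|z|^2}$ on $\mathbb C$, and let $\tilde W=\Sigma^{1/2}X^\dagger X\Sigma^{1/2}$ be the corresponding correlated complex Wishart matrix. For $\lambda=(\lambda_1,\dots,\lambda_N)$ set $$ D(\lambda)=\prod_{l=1}^N\lambda_l^{n-N}e^{-\lambda_l}\prod_{1\le j<k\le N}(\lambda_k-\lambda_j)\,\det\Big[[\lambda_j^{k-1}]_{j=1,\dots,N\atop k=1,\dots,N-1}\ [e^{c\lambda_j}]_{j=1}^N\Big]. $$ (i) There is a constant $C\neq0$ depending only on $n,N,b$ such that, for all $\lambda\in(0,\infty)^N$, $$ (\det\Sigma)^{-1/2}\prod_{l=1}^N\lambda_l^{n-N}e^{-\lambda_l}\prod_{1\le j<k\le N}(\lambda_k-\lambda_j)^2\int_{U(N)}e^{-\mathrm{Tr}\,(U\Lambda U^\dagger(\Sigma^{-1}-\mathbb I_N))}\,dU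 \;=\; C\,D(\lambda), $$ where $\Lambda=\mathrm{diag}(\lambda_1,\dots,\lambda_N)$ and $dU$ is normalised Haar measure on the unitary group $U(N)$. (ii) The joint probability density function of the $N$ (unordered) eigenvalues of $\tilde W$ is proportional to $D$: there is a constant $K\neq0$ depending only on $n,N,b$ such that $K\,D\ge0$ on $(0,\infty)^N$, and the vector of eigenvalues of $\tilde W$, listed with multiplicity in a uniformly random order, has density $K\,D(\lambda)$ on $(0,\infty)^N$ and $0$ elsewhere. -/

import Mathlib

open MeasureTheory ProbabilityTheory

noncomputable section

namespace SpikedWishart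

/-! ### The random matrix -/

/-- The standard complex Gaussian law on `ℂ`: density `π⁻¹ exp (-|z|²)` with respect to Lebesgue
measure. -/
def stdComplexGaussian : Measure ℂ :=
  volume.withDensity fun z => ENNReal.ofReal (Real.exp (-‖z‖ ^ 2) / Real.pi)

/-- `X` is a standard complex Gaussian `n × N` random matrix: its entries are independent standard
complex Gaussian random variables. -/
structure IsStdComplexGaussianMatrix {n N : ℕ} {Ω : Type*} [MeasurableSpace Ω] (P : Measure Ω)
    (X : Ω → Matrix (Fin n) (Fin N) ℂ) : Prop where
  hasLaw : ∀ i j, HasLaw (fun ω => X ω i j) stdComplexGaussian P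
  indep : iIndepFun (fun (p : Fin n × Fin N) ω => X ω p.1 p.2) P

/-- `Σ = diag (b, 1, …, 1)`, of size `N × N`. -/
def spike (N : ℕ) (b : ℝ) : Matrix (Fin N) (Fin N) ℂ :=
  Matrix.diagonal fun i => if (i : ℕ) = 0 then (b : ℂ) else 1

/-- `Σ^{1/2} = diag (√b, 1, …, 1)`. -/
def spikeSqrt (N : ℕ) (b : ℝ) : Matrix (Fin N) (Fin N) ℂ :=
  Matrix.diagonal fun i => if (i : ℕ) = 0 then ((√b : ℝ) : ℂ) else 1

open scoped ComplexOrder in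
/-- For `b > 0`, `spikeSqrt N b` is positive definite and squares to `spike N b`, so it is the
positive square root. -/
theorem spikeSqrt_spec (N : ℕ) {b : ℝ} (hb : 0 < b) :
    (spikeSqrt N b).PosDef ∧ spikeSqrt N b * spikeSqrt N b = spike N b := by
  constructor
  · rw [spikeSqrt, Matrix.posDef_diagonal_iff]
    intro i
    split_ifs
    · exact_mod_cast Real.sqrt_pos.2 hb
    · exact zero_lt_one
  · rw [spikeSqrt, spike, Matrix.diagonal_mul_diagonal]
    congr 1
    funext i
    split_ifs
    · rw [← Complex.ofReal_mul, Real.mul_self_sqrt hb.le]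
    · simp

/-- The correlated Wishart matrix `Σ^{1/2} X† X Σ^{1/2}` with `Σ = diag (b, 1, …, 1)`. -/
def wishart {n N : ℕ} (b : ℝ) (X : Matrix (Fin n) (Fin N) ℂ) : Matrix (Fin N) (Fin N) ℂ :=
  spikeSqrt N b * X.conjTranspose * X * spikeSqrt N b

theorem wishart_isHermitian {n N : ℕ} (b : ℝ) (X : Matrix (Fin n) (Fin N) ℂ) :
    (wishart b X).IsHermitian := by
  have h : (spikeSqrt N b).conjTranspose = spikeSqrt N b := by
    rw [spikeSqrt, Matrix.diagonal_conjTranspose]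
    congr 1
    funext i
    simp only [Pi.star_apply]
    split_ifs <;> simp
  simp [wishart, Matrix.IsHermitian, Matrix.conjTranspose_mul, h, Matrix.mul_assoc]

/-! ### Eigenvalue PDF -/

/-- `p` is the joint probability density function of the (unordered) eigenvalues of the random
Hermitian matrix `H`: `p` is a nonnegative measurable symmetric function on `ℝ^N`, and listing the
eigenvalues of `H` (with multiplicity) in an order chosen uniformly at random among the `N!`
relabellings gives a random vector with density `p` with respect to Lebesgue measure. -/
structure IsEigenvaluePDF {N : ℕ} {Ω : Type*} [MeasurableSpace Ω] (P : Measure Ω)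
    (H : Ω → Matrix (Fin N) (Fin N) ℂ) (hH : ∀ ω, (H ω).IsHermitian)
    (p : (Fin N → ℝ) → ℝ) : Prop where
  measurable : Measurable p
  nonneg : ∀ x, 0 ≤ p x
  symmetric : ∀ (σ : Equiv.Perm (Fin N)) (x : Fin N → ℝ), p (x ∘ σ) = p x
  aemeasurable : AEMeasurable (fun ω => (hH ω).eigenvalues) P
  law : ((Nat.factorial N : ENNReal)⁻¹ •
      ∑ σ : Equiv.Perm (Fin N), P.map fun ω => (hH ω).eigenvalues ∘ σ) =
    volume.withDensity fun x => ENNReal.ofReal (p x)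

/-! ### Haar measure on `U(N)` -/

instance unitaryMeasurableSpace (N : ℕ) :
    MeasurableSpace (Matrix.unitaryGroup (Fin N) ℂ) := borel _

instance unitaryBorelSpace (N : ℕ) : BorelSpace (Matrix.unitaryGroup (Fin N) ℂ) := ⟨rfl⟩

instance unitaryCompactSpace (N : ℕ) : CompactSpace (Matrix.unitaryGroup (Fin N) ℂ) := by
  suffices h : IsCompact (Matrix.unitaryGroup (Fin N) ℂ : Set (Matrix (Fin N) (Fin N) ℂ)) from
    isCompact_iff_compactSpace.1 h
  have hK : IsCompact (Set.univ.pi fun _ : Fin N => Set.univ.pi fun _ : Fin N =>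
      Metric.closedBall (0 : ℂ) 1) :=
    isCompact_univ_pi fun _ => isCompact_univ_pi fun _ => isCompact_closedBall 0 1
  have hC : IsClosed {U : Matrix (Fin N) (Fin N) ℂ | star U * U = 1 ∧ U * star U = 1} := by
    refine IsClosed.inter (isClosed_eq ?_ continuous_const) (isClosed_eq ?_ continuous_const)
    · exact continuous_star.mul continuous_id
    · exact continuous_id.mul continuous_star
  have hS : {U : Matrix (Fin N) (Fin N) ℂ | star U * U = 1 ∧ U * star U = 1} =
      (Matrix.unitaryGroup (Fin N) ℂ : Set (Matrix (Fin N) (Fin N) ℂ)) := by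
    ext U
    exact Unitary.mem_iff.symm
  rw [hS] at hC
  refine IsCompact.of_isClosed_subset hK hC fun U hU => ?_
  intro i _ j _
  simpa using entry_norm_bound_of_unitary hU i j

/-- Normalised Haar measure on the unitary group `U(N)` (total mass `1`). -/
def unitaryHaar (N : ℕ) : Measure (Matrix.unitaryGroup (Fin N) ℂ) :=
  Measure.haarMeasure ⊤

/-! ### The two functional forms -/

/-- The product of differences `∏_{j < k} (λ_k - λ_j)`. -/
def diffProd {N : ℕ} (x : Fin N → ℝ) : ℝ :=
  ∏ j, ∏ k ∈ Finset.Ioi j, (x k - x j)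

/-- The `U(N)` integral form
`(det Σ)^{-1/2} ∏ λ_l^{n-N} e^{-λ_l} ∏_{j<k} (λ_k - λ_j)² ∫ exp (-Tr (U Λ U† (Σ⁻¹ - 1))) dU`.
The trace is a real number, being the trace of a product of two Hermitian matrices. -/
def haarForm (n N : ℕ) (b : ℝ) (x : Fin N → ℝ) : ℝ :=
  √(1 / (spike N b).det.re) * (∏ l, x l ^ (n - N) * Real.exp (-x l)) * diffProd x ^ 2 *
    ∫ U : Matrix.unitaryGroup (Fin N) ℂ,
      Real.exp (-(Matrix.trace ((U : Matrix (Fin N) (Fin N) ℂ) *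
        Matrix.diagonal (fun i => (x i : ℂ)) * (U : Matrix (Fin N) (Fin N) ℂ).conjTranspose *
        ((spike N b)⁻¹ - 1))).re) ∂(unitaryHaar N)

/-- The `N × N` matrix whose first `N - 1` columns are `(x_j^{k-1})_j`, `k = 1, …, N - 1`, and whose
last column is `(e^{c x_j})_j`. (Here `k : Fin N` counts from `0`.) -/
def borderedVandermonde {N : ℕ} (c : ℝ) (x : Fin N → ℝ) : Matrix (Fin N) (Fin N) ℝ :=
  Matrix.of fun j k => if (k : ℕ) + 1 = N then Real.exp (c * x j) else x j ^ (k : ℕ)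

/-- The determinantal form
`∏ λ_l^{n-N} e^{-λ_l} ∏_{j<k} (λ_k - λ_j) det [[λ_j^{k-1}]_{k ≤ N-1} [e^{c λ_j}]]`,
with `c = 1 - 1/b`. -/
def detForm (n N : ℕ) (b : ℝ) (x : Fin N → ℝ) : ℝ :=
  (∏ l, x l ^ (n - N) * Real.exp (-x l)) * diffProd x *
    (borderedVandermonde (1 - 1 / b) x).det

/-- The function on `ℝ^N` equal to `f` on `(0, ∞)^N` and to `0` elsewhere. -/
def onPositive {N : ℕ} (f : (Fin N → ℝ) → ℝ) : (Fin N → ℝ) → ℝ :=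
  Set.indicator {x | ∀ l, 0 < x l} f

end SpikedWishart

end

noncomputable section

namespace SpikedWishart

section

open Finset Polynomial

/-! ### Vandermonde products and Lagrange weights -/

/-! The common object is the divided difference of `exp (c ·)` at the points `x_j`, that is `∑ exp
(c x_j) w_j` with `w_j` the Lagrange nodal weights. By Cramer's rule it is the bordered determinant
divided by the Vandermonde product (`det_borderedVandermonde`).

Part (i). `Σ⁻¹ - 1` has rank at most one, so the unitary integral involves only the squared moduli
in the first row of `U`. A complex Gaussian vector `z` is its norm times an independent row of this
kind, while the `|z_j|²` are independent exponential variables. So the mean of `F (‖z‖²) exp (∑ y_j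
|z_j|²)` can be found in two ways: through the norm it is the row integral against a Gamma density,
and directly it is a convolution of exponentials, which is a divided difference
(`hasSumDensity_exp_mul`). Comparing the two densities at radius one gives `rowIntegral_one`.

Part (ii) does not go through part (i); it is an induction on the number of columns with `n` fixed.
The nonzero spectrum of the Wishart matrix is that of `X Σ X†`, to which a new column `v` adds `v
v†`. In an eigenbasis of the old matrix `v` is still Gaussian, and the new eigenvalues solve a
secular equation with poles `α = (0, a)`. The weight at each pole `a_j` is exponential; the weight
at `0` collects all the null directions and is Gamma distributed. Passing from weights to roots is a
bijection of the positive orthant onto the interlacing region, with Jacobian `Δ(x) / Δ(α)`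
(`lintegral_Ioi_eq_lintegral_interlacing`), which yields the transition density
(`lintegral_update`).

Multiplied by the old weight `∏ a^(m+1) e^(-a) Δ(a)`, this density no longer depends on `a`
(`updateKernel_mul_laguerreWeight`). What remains is the bordered determinant integrated over `x_i <
a_i < x_{i+1}`. Entrywise integration raises each power by one and divides the exponential by `c`,
so the bordered determinant of the next size appears (`integral_gapBox_det`); this is where `b ≠ 1`
enters. The spike belongs to the first column and is settled in the base case. Averaging over
permutations turns ordered eigenvalues into unordered ones. -/

theorem diffProd_eq_det_vandermonde {N : ℕ} (x : Fin N → ℝ) :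
    diffProd x = (Matrix.vandermonde x).det := (Matrix.det_vandermonde x).symm

theorem diffProd_pos {N : ℕ} {x : Fin N → ℝ} (hx : StrictMono x) : 0 < diffProd x :=
  prod_pos fun _ _ => prod_pos fun _ hk => sub_pos.2 (hx (mem_Ioi.1 hk))

theorem diffProd_ne_zero_iff {N : ℕ} {x : Fin N → ℝ} :
    diffProd x ≠ 0 ↔ Function.Injective x := by
  rw [diffProd_eq_det_vandermonde, Matrix.det_vandermonde_ne_zero_iff]

theorem prod_erase_eq_prod_Iio_mul_prod_Ioi {N : ℕ} (j : Fin N) (f : Fin N → ℝ) :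
    ∏ i ∈ univ.erase j, f i = (∏ i ∈ Iio j, f i) * ∏ i ∈ Ioi j, f i := by
  rw [← prod_union]
  · congr 1
    ext i
    simp
  · rw [disjoint_left]
    intro i hi hi'
    exact lt_asymm (mem_Iio.1 hi) (mem_Ioi.1 hi')

theorem prod_prod_erase_abs_sub {N : ℕ} (x : Fin N → ℝ) :
    ∏ j, ∏ i ∈ univ.erase j, |x j - x i| = diffProd x ^ 2 := by
  have h : ∏ j, ∏ i ∈ Iio j, |x j - x i| = ∏ j, ∏ i ∈ Ioi j, |x i - x j| :=
    prod_comm' (by simp)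
  simp_rw [prod_erase_eq_prod_Iio_mul_prod_Ioi, prod_mul_distrib]
  rw [h, ← sq_abs, diffProd, abs_prod, sq]
  simp_rw [abs_prod]
  congr 1
  exact prod_congr rfl fun j _ => prod_congr rfl fun i _ => abs_sub_comm _ _

theorem abs_prod_nodalWeight {N : ℕ} (x : Fin N → ℝ) :
    |∏ j, Lagrange.nodalWeight univ x j| = (diffProd x ^ 2)⁻¹ := by
  rw [← prod_prod_erase_abs_sub, abs_prod, ← prod_inv_distrib]
  simp_rw [Lagrange.nodalWeight, abs_prod, abs_inv, prod_inv_distrib]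

/-- Cramer's rule for the Vandermonde system: with the last column replaced by the values of `f`,
the determinant is `diffProd x` times the top coefficient of the interpolating polynomial of `f`,
and that coefficient is the divided difference. -/
theorem det_borderedVandermonde {N : ℕ} (hN : 1 ≤ N) (c : ℝ) {x : Fin N → ℝ}
    (hx : Function.Injective x) :
    (borderedVandermonde c x).det =
      diffProd x * ∑ j, Real.exp (c * x j) * Lagrange.nodalWeight univ x j := by
  obtain ⟨m, rfl⟩ : ∃ m, N = m + 1 := ⟨N - 1, by omega⟩
  set f : Fin (m + 1) → ℝ := fun j => Real.exp (c * x j) with hf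
  set p := Lagrange.interpolate univ x f with hp
  have hdeg : p.degree < #(univ : Finset (Fin (m + 1))) :=
    Lagrange.degree_interpolate_lt f hx.injOn
  have hdeg' : p.natDegree < m + 1 := by
    by_cases h0 : p = 0
    · simp [h0]
    · rw [natDegree_lt_iff_degree_lt h0]
      simpa using hdeg
  have heval : ∀ j, p.eval (x j) = f j := fun j =>
    Lagrange.eval_interpolate_at_node f hx.injOn (mem_univ j)
  have hV : f = (Matrix.vandermonde x).mulVec fun k => p.coeff k := by
    funext j
    rw [← heval j, eval_eq_sum_range' hdeg', Matrix.mulVec, dotProduct, sum_range]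
    exact sum_congr rfl fun k _ => by rw [Matrix.vandermonde_apply, mul_comm]
  have hB : borderedVandermonde c x = (Matrix.vandermonde x).updateCol (Fin.last m) f := by
    ext j k
    by_cases hk : k = Fin.last m
    · subst hk
      simp [borderedVandermonde, hf]
    · have : (k : ℕ) ≠ m := fun h => hk (Fin.ext h)
      simp [borderedVandermonde, hk, this, Matrix.vandermonde_apply]
  have hcr : (Matrix.vandermonde x).cramer f =
      (Matrix.vandermonde x).det • fun k : Fin (m + 1) => p.coeff k := by
    conv_lhs => rw [hV]
    rw [Matrix.cramer_eq_adjugate_mulVec, Matrix.mulVec_mulVec, Matrix.adjugate_mul,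
      Matrix.smul_mulVec, Matrix.one_mulVec]
  have hc := Lagrange.coeff_eq_sum (hx.injOn (s := (univ : Finset (Fin (m + 1))))) hdeg
  rw [card_univ, Fintype.card_fin, Nat.add_sub_cancel] at hc
  rw [hB, ← Matrix.cramer_apply, hcr, diffProd_eq_det_vandermonde, Pi.smul_apply, smul_eq_mul,
    Fin.val_last, hc]
  congr 1
  refine sum_congr rfl fun j _ => ?_
  rw [heval, div_eq_mul_inv, Lagrange.nodalWeight, prod_inv_distrib]

/-! ### The secular equation as a change of variables -/

/-- The weights `q` for which `∏ (z - x_k) = ∏ (z - α_i) - ∑ q_j ∏_{i ≠ j} (z - α_i)`. -/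
def secularWeights {m : ℕ} (α x : Fin m → ℝ) : Fin m → ℝ := fun j =>
  -(∏ k, (α j - x k)) * Lagrange.nodalWeight univ α j

/-- The points `x` with `α_0 < x_0 < α_1 < x_1 < ⋯ < α_{m-1} < x_{m-1}`. -/
def interlacing {m : ℕ} (α : Fin m → ℝ) : Set (Fin m → ℝ) :=
  {x | ∀ j, α j < x j ∧ ∀ i, j < i → x j < α i}

theorem strictMono_of_mem_interlacing {m : ℕ} {α x : Fin m → ℝ} (hx : x ∈ interlacing α) :
    StrictMono x := fun _ i hi => ((hx _).2 i hi).trans (hx i).1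

theorem measurableSet_interlacing {m : ℕ} (α : Fin m → ℝ) : MeasurableSet (interlacing α) := by
  simp only [interlacing, Set.ofPred_forall, Set.ofPred_and]
  refine MeasurableSet.iInter fun j => MeasurableSet.inter ?_ ?_
  · exact measurableSet_lt measurable_const (measurable_pi_apply j)
  · exact MeasurableSet.iInter fun i => MeasurableSet.iInter fun _ =>
      measurableSet_lt (measurable_pi_apply j) measurable_const

theorem degree_nodal_sub_nodal_lt {m : ℕ} (α x : Fin m → ℝ) :
    (Lagrange.nodal univ α - Lagrange.nodal univ x).degree < #(univ : Finset (Fin m)) := by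
  rw [← Lagrange.degree_nodal (R := ℝ) (v := α)]
  refine degree_sub_lt_left ?_ Lagrange.nodal_ne_zero ?_
  · rw [Lagrange.degree_nodal, Lagrange.degree_nodal]
  · rw [Lagrange.nodal_monic, Lagrange.nodal_monic]

/-- Compare the subleading coefficients of `∏ (z - α_i)` and `∏ (z - x_k)`. In the rank one update
this is the trace identity, and it evaluates the exponential factor of the transition density. -/
theorem sum_secularWeights {m : ℕ} {α : Fin m → ℝ} (hα : Function.Injective α)
    (x : Fin m → ℝ) : ∑ j, secularWeights α x j = ∑ j, x j - ∑ j, α j := by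
  rcases Nat.eq_zero_or_pos m with rfl | hm
  · simp
  have h := Lagrange.coeff_eq_sum (hα.injOn (s := (univ : Finset (Fin m))))
    (degree_nodal_sub_nodal_lt α x)
  have hc : ∀ y : Fin m → ℝ,
      (Lagrange.nodal univ y).coeff (#(univ : Finset (Fin m)) - 1) = -∑ j, y j := fun y => by
    rw [Lagrange.nodal]
    exact prod_X_sub_C_coeff_card_pred univ y (by simpa using hm)
  rw [coeff_sub, hc, hc] at h
  have : ∑ j, x j - ∑ j, α j = -∑ j, α j - -∑ j, x j := by ring
  rw [this, h]
  refine sum_congr rfl fun j _ => ?_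
  rw [eval_sub, Lagrange.eval_nodal_at_node (mem_univ j), Lagrange.eval_nodal, zero_sub,
    div_eq_mul_inv, secularWeights, Lagrange.nodalWeight, prod_inv_distrib]

theorem nodalWeight_mul_prod_erase {m : ℕ} {α : Fin m → ℝ} (hα : Function.Injective α)
    (j : Fin m) : Lagrange.nodalWeight univ α j * ∏ i ∈ univ.erase j, (α j - α i) = 1 := by
  rw [Lagrange.nodalWeight, prod_inv_distrib, inv_mul_cancel₀]
  exact prod_ne_zero_iff.2 fun i hi =>
    sub_ne_zero.2 fun h => (mem_erase.1 hi).1 (hα h).symm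

/-- The polynomial identity that characterises `secularWeights`. -/
theorem prod_sub_eq_of_secularWeights {m : ℕ} {α : Fin m → ℝ} (hα : Function.Injective α)
    (x : Fin m → ℝ) (z : ℝ) :
    ∏ k, (z - x k) = ∏ i, (z - α i) -
      ∑ j, secularWeights α x j * ∏ i ∈ univ.erase j, (z - α i) := by
  have h : Lagrange.nodal univ α - Lagrange.nodal univ x =
      ∑ j, C (secularWeights α x j) * Lagrange.nodal (univ.erase j) α := by
    -- Both sides have degree below `m`, so agreement at the `m` nodes suffices; at `α j` only the
    -- `j`-th summand survives.
    refine Polynomial.eq_of_degrees_lt_of_eval_index_eq univ hα.injOn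
      (degree_nodal_sub_nodal_lt α x) ?_ ?_
    · refine (degree_sum_le _ _).trans_lt ((Finset.sup_lt_iff (by simp [bot_lt_iff_ne_bot])).2 ?_)
      intro j _
      refine (degree_mul_le _ _).trans_lt ?_
      refine (add_le_add_left degree_C_le _).trans_lt ?_
      rw [zero_add, Lagrange.degree_nodal]
      exact_mod_cast card_erase_lt_of_mem (mem_univ j)
    · intro j _
      rw [eval_sub, Lagrange.eval_nodal_at_node (mem_univ j), Lagrange.eval_nodal, zero_sub,
        eval_finsetSum, sum_eq_single j]
      · rw [eval_mul, eval_C, Lagrange.eval_nodal, secularWeights, mul_assoc,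
          nodalWeight_mul_prod_erase hα, mul_one]
      · intro i _ hij
        rw [eval_mul, Lagrange.eval_nodal_at_node (mem_erase.2 ⟨hij.symm, mem_univ _⟩), mul_zero]
      · simp
  have h' := congrArg (eval z) h
  simp only [eval_sub, Lagrange.eval_nodal, eval_finsetSum, eval_mul, eval_C] at h'
  linarith

/-- The weights determine the polynomial `∏ (z - x_k)`, hence its set of roots, and a finite set has
only one increasing enumeration. -/
theorem secularWeights_injOn {m : ℕ} {α : Fin m → ℝ} (hα : Function.Injective α) :
    Set.InjOn (secularWeights α) {x | StrictMono x} := by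
  intro x hx y hy hxy
  have h : ∀ z, ∏ k, (z - x k) = ∏ k, (z - y k) := fun z => by
    rw [prod_sub_eq_of_secularWeights hα x, prod_sub_eq_of_secularWeights hα y, hxy]
  have hr : Set.range x = Set.range y := by
    have aux : ∀ x y : Fin m → ℝ, (∀ z, ∏ k, (z - x k) = ∏ k, (z - y k)) →
        Set.range x ⊆ Set.range y := by
      rintro x y h _ ⟨i, rfl⟩
      have h0 : ∏ k, (x i - y k) = 0 := by
        rw [← h, prod_eq_zero (mem_univ i) (sub_self _)]
      obtain ⟨k, -, hk⟩ := prod_eq_zero_iff.1 h0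
      exact ⟨k, (sub_eq_zero.1 hk).symm⟩
    exact (aux x y h).antisymm (aux y x fun z => (h z).symm)
  exact (StrictMono.range_inj hx hy).1 hr

/-- The negative factors are those with `i > j`, and there are `m - 1 - j` of them. -/
theorem neg_one_pow_mul_prod_erase_pos {m : ℕ} {α : Fin m → ℝ} (hα : StrictMono α)
    (j : Fin m) : 0 < (-1) ^ (m - 1 - (j : ℕ)) * ∏ i ∈ univ.erase j, (α j - α i) := by
  have h : (-1 : ℝ) ^ (m - 1 - (j : ℕ)) * ∏ i ∈ univ.erase j, (α j - α i) =
      (∏ i ∈ Iio j, (α j - α i)) * ∏ i ∈ Ioi j, (α i - α j) := by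
    have h1 : ∏ i ∈ Ioi j, (α i - α j) =
        (-1) ^ (m - 1 - (j : ℕ)) * ∏ i ∈ Ioi j, (α j - α i) := by
      rw [← Fin.card_Ioi, ← prod_const, ← prod_mul_distrib]
      exact prod_congr rfl fun i _ => by ring
    rw [h1, prod_erase_eq_prod_Iio_mul_prod_Ioi]
    ring
  rw [h]
  exact mul_pos (prod_pos fun i hi => sub_pos.2 (hα (mem_Iio.1 hi)))
    (prod_pos fun i hi => sub_pos.2 (hα (mem_Ioi.1 hi)))

/-- For positive `q` the polynomial `p` alternates in sign at the nodes, is negative at the largest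
node and tends to `+∞`. The intermediate value theorem gives one root in each gap and one beyond the
last node. -/
theorem exists_secularWeights_eq {m : ℕ} {α : Fin m → ℝ} (hα : StrictMono α) {q : Fin m → ℝ}
    (hq : ∀ j, 0 < q j) : ∃ x ∈ interlacing α, secularWeights α x = q := by
  set p : ℝ[X] := Lagrange.nodal univ α - ∑ j, C (q j) * Lagrange.nodal (univ.erase j) α with hp
  have hlow : (∑ j, C (q j) * Lagrange.nodal (univ.erase j) α).degree <
      (Lagrange.nodal univ α).degree := by
    rw [Lagrange.degree_nodal]
    refine (degree_sum_le _ _).trans_lt ((Finset.sup_lt_iff (by simp [bot_lt_iff_ne_bot])).2 ?_)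
    intro j _
    refine (degree_mul_le _ _).trans_lt ?_
    refine (add_le_add_left degree_C_le _).trans_lt ?_
    rw [zero_add, Lagrange.degree_nodal]
    exact_mod_cast card_erase_lt_of_mem (mem_univ j)
  have hdeg : p.degree = #(univ : Finset (Fin m)) := by
    rw [hp, degree_sub_eq_left_of_degree_lt hlow, Lagrange.degree_nodal]
  have hlead : p.leadingCoeff = 1 := by
    rw [hp, leadingCoeff_sub_of_degree_lt hlow, Lagrange.nodal_monic]
  have heval : ∀ j, p.eval (α j) = -(q j * ∏ i ∈ univ.erase j, (α j - α i)) := by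
    intro j
    rw [hp, eval_sub, Lagrange.eval_nodal_at_node (mem_univ j), zero_sub, eval_finsetSum,
      sum_eq_single j]
    · rw [eval_mul, eval_C, Lagrange.eval_nodal]
    · intro i _ hij
      rw [eval_mul, Lagrange.eval_nodal_at_node (mem_erase.2 ⟨hij.symm, mem_univ _⟩), mul_zero]
    · simp
  have hsign : ∀ j : Fin m, (-1) ^ (m - 1 - (j : ℕ)) * p.eval (α j) < 0 := by
    intro j
    rw [heval]
    have := mul_pos (hq j) (neg_one_pow_mul_prod_erase_pos hα j)
    linarith
  have hroot : ∀ j, ∃ y, α j < y ∧ (∀ i, j < i → y < α i) ∧ p.eval y = 0 := by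
    intro j
    by_cases hj : (j : ℕ) + 1 < m
    · set j' : Fin m := ⟨j + 1, hj⟩
      have hlt : α j < α j' := hα (Fin.lt_def.2 (Nat.lt_succ_self _))
      have h1 := hsign j
      have h2 := hsign j'
      -- The exponent drops by one from `j` to `j'`, so a common sign factor `s` exhibits opposite
      -- signs at the two ends of the gap.
      have he : m - 1 - (j : ℕ) = (m - 1 - (j' : ℕ)) + 1 := by
        simp only [j']
        omega
      rw [he, pow_succ] at h1
      set s : ℝ := (-1) ^ (m - 1 - (j' : ℕ))
      have hiv : (0 : ℝ) ∈ (fun y => s * p.eval y) '' Set.Ioo (α j) (α j') := by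
        refine intermediate_value_Ioo' hlt.le (by fun_prop) ⟨h2, ?_⟩
        linarith
      obtain ⟨y, hy, hy0⟩ := hiv
      refine ⟨y, hy.1, fun i hi => hy.2.trans_le (hα.monotone ?_), ?_⟩
      · exact Fin.le_def.2 (Nat.succ_le_of_lt (Fin.lt_def.1 hi))
      · have hs : s ≠ 0 := pow_ne_zero _ (by norm_num)
        exact (mul_eq_zero.1 hy0).resolve_left hs
    · have hjm : (j : ℕ) = m - 1 := by have := j.isLt; omega
      have h1 := hsign j
      rw [hjm, Nat.sub_self, pow_zero, one_mul] at h1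
      have hm : 0 < m := j.pos
      have htend := p.tendsto_atTop_of_leadingCoeff_nonneg
        (by rw [hdeg]; simpa using hm) (by rw [hlead]; norm_num)
      obtain ⟨B, hB, hBα⟩ := ((htend.eventually_gt_atTop 0).and
        (Filter.eventually_gt_atTop (α j))).exists
      have hiv : (0 : ℝ) ∈ (fun y => p.eval y) '' Set.Ioo (α j) B :=
        intermediate_value_Ioo hBα.le (by fun_prop) ⟨h1, hB⟩
      obtain ⟨y, hy, hy0⟩ := hiv
      refine ⟨y, hy.1, fun i hi => ?_, hy0⟩
      have := Fin.lt_def.1 hi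
      omega
  choose x hx1 hx2 hx3 using hroot
  have hx : x ∈ interlacing α := fun j => ⟨hx1 j, hx2 j⟩
  refine ⟨x, hx, ?_⟩
  -- The `m` distinct roots found exhaust a monic polynomial of degree `m`.
  have hpx : p = Lagrange.nodal univ x := by
    refine Polynomial.eq_of_degree_le_of_eval_index_eq univ
      (strictMono_of_mem_interlacing hx).injective.injOn hdeg.le ?_ ?_ ?_
    · rw [hdeg, Lagrange.degree_nodal]
    · rw [hlead, Lagrange.nodal_monic]
    · intro j _
      rw [hx3, Lagrange.eval_nodal_at_node (mem_univ j)]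
  funext j
  have h := heval j
  rw [hpx, Lagrange.eval_nodal] at h
  rw [secularWeights, h, neg_neg, mul_assoc, mul_comm (∏ i ∈ _, _),
    nodalWeight_mul_prod_erase hα.injective, mul_one]

/-- Interlacing makes exactly the factors `α j - x k` with `k ≥ j` negative. This is one more sign
than in the nodal weight, and the leading minus sign compensates for it. -/
theorem secularWeights_pos {m : ℕ} {α x : Fin m → ℝ} (hα : StrictMono α)
    (hx : x ∈ interlacing α) (j : Fin m) : 0 < secularWeights α x j := by
  have h1 : 0 < (-1) ^ (m - 1 - (j : ℕ)) * (-∏ k, (α j - x k)) := by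
    have h2 : ∏ k ∈ Ioi j, (x k - α j) =
        (-1) ^ (m - 1 - (j : ℕ)) * ∏ k ∈ Ioi j, (α j - x k) := by
      rw [← Fin.card_Ioi, ← prod_const, ← prod_mul_distrib]
      exact prod_congr rfl fun i _ => by ring
    have h3 : (-1) ^ (m - 1 - (j : ℕ)) * (-∏ k, (α j - x k)) =
        (∏ k ∈ Iio j, (α j - x k)) * (∏ k ∈ Ioi j, (x k - α j)) * (x j - α j) := by
      rw [h2, ← mul_prod_erase univ _ (mem_univ j), prod_erase_eq_prod_Iio_mul_prod_Ioi]
      ring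
    rw [h3]
    refine mul_pos (mul_pos ?_ ?_) (sub_pos.2 (hx j).1)
    · exact prod_pos fun k hk => sub_pos.2 ((hx k).2 j (mem_Iio.1 hk))
    · exact prod_pos fun k hk => sub_pos.2 ((hα (mem_Ioi.1 hk)).trans (hx k).1)
  have h4 := neg_one_pow_mul_prod_erase_pos hα j
  have h5 := mul_pos h1 (inv_pos.2 h4)
  have hs : ((-1 : ℝ) ^ (m - 1 - (j : ℕ))) ≠ 0 := pow_ne_zero _ (by norm_num)
  rw [secularWeights, Lagrange.nodalWeight, prod_inv_distrib]
  refine h5.trans_eq ?_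
  rw [mul_inv]
  field_simp

theorem image_secularWeights {m : ℕ} {α : Fin m → ℝ} (hα : StrictMono α) :
    secularWeights α '' interlacing α = Set.univ.pi fun _ => Set.Ioi 0 := by
  ext q
  simp only [Set.mem_image, Set.mem_pi, Set.mem_univ, Set.mem_Ioi, true_implies]
  constructor
  · rintro ⟨x, hx, rfl⟩ j
    exact secularWeights_pos hα hx j
  · exact fun hq => exists_secularWeights_eq hα hq

/-- The Jacobian matrix of `secularWeights α` at `x`. -/
def secularJacobian {m : ℕ} (α x : Fin m → ℝ) : Matrix (Fin m) (Fin m) ℝ :=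
  Matrix.of fun j k => Lagrange.nodalWeight univ α j * ∏ l ∈ univ.erase k, (α j - x l)

/-- The columns of `Q` hold the coefficients of `∏_{l ≠ k} (z - x_l)`. Evaluating at `α` gives the
Jacobian up to nodal weights; evaluating at `x` gives a diagonal matrix, whence `|det Q| = Δ(x)`.
Together with the factors `Δ(α)` and `Δ(α)⁻²` this leaves the quotient. -/
theorem abs_det_secularJacobian {m : ℕ} {α x : Fin m → ℝ} (hα : StrictMono α)
    (hx : StrictMono x) : |(secularJacobian α x).det| = diffProd x / diffProd α := by
  set Q : Matrix (Fin m) (Fin m) ℝ :=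
    Matrix.of fun i k => (Lagrange.nodal (univ.erase k) x).coeff i with hQ
  have hdeg : ∀ k : Fin m, (Lagrange.nodal (univ.erase k) x).natDegree < m := fun k => by
    rw [Lagrange.natDegree_nodal]
    simpa using card_erase_lt_of_mem (mem_univ k)
  have hVQ : ∀ y : Fin m → ℝ, Matrix.vandermonde y * Q =
      Matrix.of fun j k => ∏ l ∈ univ.erase k, (y j - x l) := by
    intro y
    ext j k
    rw [Matrix.mul_apply, Matrix.of_apply, ← Lagrange.eval_nodal, eval_eq_sum_range' (hdeg k),
      sum_range]
    exact sum_congr rfl fun i _ => by rw [Matrix.vandermonde_apply, hQ, Matrix.of_apply, mul_comm]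
  have hJ : secularJacobian α x =
      Matrix.diagonal (Lagrange.nodalWeight univ α) * (Matrix.vandermonde α * Q) := by
    rw [hVQ]
    ext j k
    rw [Matrix.diagonal_mul]
    rfl
  have hD : Matrix.vandermonde x * Q =
      Matrix.diagonal fun k => ∏ l ∈ univ.erase k, (x k - x l) := by
    rw [hVQ]
    ext j k
    by_cases hjk : j = k
    · subst hjk
      simp
    · rw [Matrix.diagonal_apply_ne _ hjk, Matrix.of_apply]
      exact prod_eq_zero (mem_erase.2 ⟨hjk, mem_univ _⟩) (sub_self _)
  have hdQ : diffProd x * |Q.det| = diffProd x ^ 2 := by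
    have := congrArg (fun M => |Matrix.det M|) hD
    simp only [Matrix.det_mul, Matrix.det_diagonal, abs_mul, abs_prod] at this
    rw [← prod_prod_erase_abs_sub, ← this, ← diffProd_eq_det_vandermonde,
      abs_of_pos (diffProd_pos hx)]
  have hx0 := diffProd_pos hx
  have hα0 := diffProd_pos hα
  have hQd : |Q.det| = diffProd x := by
    rw [sq] at hdQ
    exact mul_left_cancel₀ hx0.ne' hdQ
  rw [hJ, Matrix.det_mul, Matrix.det_mul, Matrix.det_diagonal, abs_mul, abs_mul, hQd,
    abs_prod_nodalWeight, ← diffProd_eq_det_vandermonde, abs_of_pos hα0]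
  field_simp

theorem hasFDerivAt_secularWeights {m : ℕ} (α x : Fin m → ℝ) :
    HasFDerivAt (secularWeights α)
      (LinearMap.toContinuousLinearMap (Matrix.toLin' (secularJacobian α x))) x := by
  rw [hasFDerivAt_pi']
  intro j
  have h1 : ∀ k ∈ (univ : Finset (Fin m)), HasFDerivAt (fun y : Fin m → ℝ => α j - y k)
      (-(ContinuousLinearMap.proj k : (Fin m → ℝ) →L[ℝ] ℝ)) x := fun k _ =>
    (hasFDerivAt_apply k x).const_sub (α j)
  have h2 := ((HasFDerivAt.finsetProd h1).neg.mul_const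
    (Lagrange.nodalWeight univ α j))
  refine h2.congr_fderiv ?_
  ext v
  simp [secularJacobian, Matrix.mulVec, dotProduct, mul_sum, mul_assoc]

theorem lintegral_Ioi_eq_lintegral_interlacing {m : ℕ} {α : Fin m → ℝ} (hα : StrictMono α)
    (g : (Fin m → ℝ) → ENNReal) :
    ∫⁻ q in Set.univ.pi fun _ => Set.Ioi 0, g q =
      ∫⁻ x in interlacing α, ENNReal.ofReal (diffProd x / diffProd α) *
        g (secularWeights α x) := by
  rw [← image_secularWeights hα, lintegral_image_eq_lintegral_abs_det_fderiv_mul volume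
    (measurableSet_interlacing α) (fun x _ => (hasFDerivAt_secularWeights α x).hasFDerivWithinAt)
    ((secularWeights_injOn hα.injective).mono fun x hx => strictMono_of_mem_interlacing hx)]
  refine setLIntegral_congr_fun (measurableSet_interlacing α) fun x hx => ?_
  rw [ContinuousLinearMap.det, LinearMap.coe_toContinuousLinearMap, LinearMap.det_toLin',
    abs_det_secularJacobian hα (strictMono_of_mem_interlacing hx)]

end

section

open Finset

/-! ### Product measures -/

theorem lintegral_pi_insertNth {n : ℕ} {E : Type*} [MeasurableSpace E] (μ : Fin (n + 1) → Measure E)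
    [∀ i, SigmaFinite (μ i)] (i : Fin (n + 1)) {F : (Fin (n + 1) → E) → ENNReal}
    (hF : Measurable F) :
    ∫⁻ x, F x ∂Measure.pi μ =
      ∫⁻ a, ∫⁻ y, F (i.insertNth a y) ∂(Measure.pi fun j => μ (i.succAbove j)) ∂μ i := by
  have h := (measurePreserving_piFinSuccAbove μ i).symm
  rw [← h.lintegral_comp hF]
  exact lintegral_prod _ (hF.comp h.measurable).aemeasurable

theorem lintegral_pi_prod {n : ℕ} {E : Type*} [MeasurableSpace E] (μ : Fin n → Measure E)
    [∀ i, SigmaFinite (μ i)] {f : Fin n → E → ENNReal} (hf : ∀ i, Measurable (f i)) :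
    ∫⁻ x, ∏ i, f i (x i) ∂Measure.pi μ = ∏ i, ∫⁻ x, f i x ∂μ i := by
  induction n with
  | zero => simp
  | succ n ih =>
    rw [lintegral_pi_insertNth μ 0 (by fun_prop), Fin.prod_univ_succ]
    simp_rw [Fin.prod_univ_succ, Fin.insertNth_zero', Fin.cons_zero, Fin.cons_succ]
    have h : ∀ a : E, ∫⁻ y : Fin n → E, f 0 a * ∏ i : Fin n, f i.succ (y i)
        ∂(Measure.pi fun j => μ (Fin.succAbove 0 j)) = f 0 a * ∏ i : Fin n, ∫⁻ x, f i.succ x ∂μ i.succ := by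
      intro a
      rw [lintegral_const_mul _ (by fun_prop)]
      congr 1
      exact ih (fun i => μ i.succ) fun i => hf i.succ
    simp_rw [h]
    rw [lintegral_mul_const _ (hf 0)]

theorem pi_withDensity {n : ℕ} {E : Type*} [MeasurableSpace E] (μ : Fin n → Measure E)
    [∀ i, SigmaFinite (μ i)] {f : Fin n → E → ENNReal} (hf : ∀ i, Measurable (f i))
    [∀ i, SigmaFinite ((μ i).withDensity (f i))] :
    Measure.pi (fun i => (μ i).withDensity (f i)) =
      (Measure.pi μ).withDensity fun x => ∏ i, f i (x i) := by
  refine Measure.pi_eq fun s hs => ?_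
  rw [withDensity_apply _ (MeasurableSet.univ_pi hs), Measure.restrict_pi_pi, lintegral_pi_prod _ hf]
  exact prod_congr rfl fun i _ => (withDensity_apply _ (hs i)).symm

/-! ### The complex Gaussian -/

theorem lintegral_sq_norm_stdComplexGaussian {f : ℝ → ENNReal} (hf : Measurable f) :
    ∫⁻ z, f (‖z‖ ^ 2) ∂stdComplexGaussian =
      ∫⁻ t in Set.Ioi 0, ENNReal.ofReal (Real.exp (-t)) * f t := by
  have hm : Measurable fun z : ℂ => ENNReal.ofReal (Real.exp (-‖z‖ ^ 2) / Real.pi) := by fun_prop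
  rw [stdComplexGaussian, lintegral_withDensity_eq_lintegral_mul _ hm (by fun_prop),
    ← Complex.lintegral_comp_polarCoord_symm]
  have h1 : ∀ p ∈ polarCoord.target, ENNReal.ofReal p.1 •
      ((fun z : ℂ => ENNReal.ofReal (Real.exp (-‖z‖ ^ 2) / Real.pi)) * fun z : ℂ => f (‖z‖ ^ 2))
        (Complex.polarCoord.symm p) =
      (ENNReal.ofReal (p.1 * (Real.exp (-p.1 ^ 2) / Real.pi)) * f (p.1 ^ 2)) * 1 := by
    intro p hp
    have hp0 : 0 < p.1 := hp.1
    rw [smul_eq_mul, Pi.mul_apply, Complex.norm_polarCoord_symm, sq_abs, mul_one, ← mul_assoc,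
      ENNReal.ofReal_mul hp0.le]
  rw [setLIntegral_congr_fun polarCoord.open_target.measurableSet h1, polarCoord_target,
    Measure.volume_eq_prod, ← Measure.prod_restrict,
    lintegral_prod_mul (f := fun r : ℝ =>
      ENNReal.ofReal (r * (Real.exp (-r ^ 2) / Real.pi)) * f (r ^ 2)) (g := fun _ => 1)
      (by fun_prop) (by fun_prop)]
  -- The angle contributes `2π`, which turns `r / π` into the Jacobian `2 r` of `t = r²`.
  rw [setLIntegral_one, Real.volume_Ioo, ← lintegral_mul_const _ (by fun_prop)]
  have himg : (fun r : ℝ => r ^ 2) '' Set.Ioi 0 = Set.Ioi 0 := by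
    ext t
    simp only [Set.mem_image, Set.mem_Ioi]
    exact ⟨fun ⟨r, hr, h⟩ => h ▸ by positivity,
      fun ht => ⟨√t, Real.sqrt_pos.2 ht, Real.sq_sqrt ht.le⟩⟩
  conv_rhs => rw [← himg]
  rw [lintegral_image_eq_lintegral_abs_deriv_mul measurableSet_Ioi
    (fun r _ => (hasDerivAt_pow 2 r).hasDerivWithinAt)
    (fun a ha b hb h => (pow_left_inj₀ (le_of_lt ha) (le_of_lt hb) two_ne_zero).1 h)]
  refine setLIntegral_congr_fun measurableSet_Ioi fun r hr => ?_
  have hr0 : 0 < r := hr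
  rw [mul_right_comm, ← ENNReal.ofReal_mul (by positivity), ← mul_assoc,
    ← ENNReal.ofReal_mul (by positivity)]
  congr 2
  rw [abs_of_pos (by positivity)]
  field_simp
  ring

theorem lintegral_exp_neg_Ioi : ∫⁻ t in Set.Ioi (0 : ℝ), ENNReal.ofReal (Real.exp (-t)) = 1 := by
  rw [← ofReal_integral_eq_lintegral_ofReal]
  · rw [integral_exp_neg_Ioi_zero]
    simp
  · exact integrableOn_exp_neg_Ioi 0
  · exact Filter.Eventually.of_forall fun t => (Real.exp_pos _).le

instance : IsProbabilityMeasure stdComplexGaussian := by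
  refine ⟨?_⟩
  rw [← lintegral_one, lintegral_sq_norm_stdComplexGaussian (f := fun _ => 1) measurable_const]
  simpa using lintegral_exp_neg_Ioi

/-- The law of a vector of `n` independent standard complex Gaussian random variables. -/
def gaussianVector (n : ℕ) : Measure (Fin n → ℂ) := Measure.pi fun _ => stdComplexGaussian

instance (n : ℕ) : IsProbabilityMeasure (gaussianVector n) := by
  unfold gaussianVector
  infer_instance

theorem gaussianVector_eq_withDensity (n : ℕ) :
    gaussianVector n = volume.withDensity fun z : Fin n → ℂ =>
      ENNReal.ofReal (Real.exp (-∑ i, ‖z i‖ ^ 2) / Real.pi ^ n) := by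
  have : SigmaFinite ((volume : Measure ℂ).withDensity fun z =>
      ENNReal.ofReal (Real.exp (-‖z‖ ^ 2) / Real.pi)) :=
    inferInstanceAs (SigmaFinite stdComplexGaussian)
  rw [gaussianVector]
  unfold stdComplexGaussian
  rw [pi_withDensity _ (fun _ => by fun_prop)]
  congr 1
  funext z
  rw [← ENNReal.ofReal_prod_of_nonneg (fun i _ => by positivity), prod_div_distrib, prod_const,
    card_univ, Fintype.card_fin, ← Real.exp_sum]
  simp

theorem sum_sq_norm_mulVec_of_unitary {n : ℕ} {U : Matrix (Fin n) (Fin n) ℂ}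
    (hU : U.conjTranspose * U = 1) (z : Fin n → ℂ) :
    ∑ i, ‖U.mulVec z i‖ ^ 2 = ∑ i, ‖z i‖ ^ 2 := by
  have h : ∀ w : Fin n → ℂ, ((∑ i, ‖w i‖ ^ 2 : ℝ) : ℂ) = star w ⬝ᵥ w := fun w => by
    simp only [dotProduct, Pi.star_apply, Complex.ofReal_sum, Complex.ofReal_pow]
    exact sum_congr rfl fun i _ => (Complex.conj_mul' _).symm
  have h2 : star (U.mulVec z) ⬝ᵥ U.mulVec z = star z ⬝ᵥ z := by
    rw [Matrix.star_mulVec, Matrix.dotProduct_mulVec, Matrix.vecMul_vecMul, hU, Matrix.vecMul_one]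
  exact_mod_cast (h _).trans (h2.trans (h z).symm)

/-- The complex Gaussian vector is invariant under unitary transformations. -/
theorem map_mulVec_gaussianVector {n : ℕ} {U : Matrix (Fin n) (Fin n) ℂ}
    (hU : U.conjTranspose * U = 1) :
    (gaussianVector n).map (fun z => U.mulVec z) = gaussianVector n := by
  set f : (Fin n → ℂ) →ₗ[ℝ] (Fin n → ℂ) := U.mulVecLin.restrictScalars ℝ with hf
  have hfU : ∀ z, f z = U.mulVec z := fun z => rfl
  have hcont : Continuous f := f.continuous_of_finiteDimensional
  have hinj : Function.Injective f := fun x y h => by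
    have := congrArg (U.conjTranspose.mulVec) h
    rwa [hfU, hfU, Matrix.mulVec_mulVec, Matrix.mulVec_mulVec, hU, Matrix.one_mulVec,
      Matrix.one_mulVec] at this
  have hdet : LinearMap.det f ≠ 0 := by
    have hu : IsUnit f := (Module.End.isUnit_iff f).2
      ⟨hinj, LinearMap.injective_iff_surjective.1 hinj⟩
    exact (hu.map (LinearMap.det : _ →* ℝ)).ne_zero
  have hv := Measure.map_linearMap_addHaar_eq_smul_addHaar (volume : Measure (Fin n → ℂ)) hdet
  set k := ENNReal.ofReal |(LinearMap.det f)⁻¹|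
  have hm : Measurable fun z : Fin n → ℂ =>
      ENNReal.ofReal (Real.exp (-∑ i, ‖z i‖ ^ 2) / Real.pi ^ n) := by fun_prop
  have h1 : (gaussianVector n).map f = k • gaussianVector n := by
    ext s hs
    rw [Measure.map_apply hcont.measurable hs, gaussianVector_eq_withDensity,
      withDensity_apply _ (hcont.measurable hs), ← withDensity_smul_measure, ← hv,
      withDensity_apply _ hs, setLIntegral_map hs hm hcont.measurable]
    refine setLIntegral_congr_fun (hcont.measurable hs) fun z _ => ?_
    simp only [hfU]
    rw [sum_sq_norm_mulVec_of_unitary hU]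
  -- Both measures are probability measures, so the Jacobian constant `k` equals `1` and the
  -- determinant of `f` need not be computed.
  have h2 := congrArg (fun μ => μ Set.univ) h1
  rw [Measure.map_apply hcont.measurable MeasurableSet.univ, Set.preimage_univ, measure_univ,
    Measure.smul_apply, measure_univ, smul_eq_mul, mul_one] at h2
  rw [← h2, one_smul] at h1
  exact h1

/-- Lebesgue measure on the half line with density `exp (-t)`. -/
def expLaw : Measure ℝ :=
  (volume.restrict (Set.Ioi 0)).withDensity fun t => ENNReal.ofReal (Real.exp (-t))

theorem map_sq_norm_stdComplexGaussian :
    stdComplexGaussian.map (fun z => ‖z‖ ^ 2) = expLaw := by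
  ext s hs
  rw [← lintegral_indicator_one hs, lintegral_map (measurable_one.indicator hs) (by fun_prop),
    lintegral_sq_norm_stdComplexGaussian (measurable_one.indicator hs), expLaw,
    ← lintegral_indicator_one hs,
    lintegral_withDensity_eq_lintegral_mul _ (by fun_prop) (measurable_one.indicator hs)]
  rfl

instance : IsProbabilityMeasure expLaw := by
  rw [← map_sq_norm_stdComplexGaussian]
  exact Measure.isProbabilityMeasure_map (by fun_prop)

theorem map_sq_norm_gaussianVector (n : ℕ) :
    (gaussianVector n).map (fun z i => ‖z i‖ ^ 2) = Measure.pi fun _ : Fin n => expLaw := by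
  rw [gaussianVector, ← map_sq_norm_stdComplexGaussian]
  have : IsProbabilityMeasure (stdComplexGaussian.map fun z => ‖z‖ ^ 2) :=
    Measure.isProbabilityMeasure_map (by fun_prop)
  exact Measure.pi_map_pi (f := fun _ : Fin n => fun z : ℂ => ‖z‖ ^ 2) fun _ => by fun_prop

theorem lintegral_pi_expLaw {n : ℕ} {F : (Fin n → ℝ) → ENNReal} (hF : Measurable F) :
    ∫⁻ t, F t ∂(Measure.pi fun _ : Fin n => expLaw) =
      ∫⁻ t in Set.univ.pi fun _ => Set.Ioi 0, F t * ∏ i, ENNReal.ofReal (Real.exp (-t i)) := by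
  have : SigmaFinite (((volume : Measure ℝ).restrict (Set.Ioi 0)).withDensity fun t =>
      ENNReal.ofReal (Real.exp (-t))) := inferInstanceAs (SigmaFinite expLaw)
  unfold expLaw
  rw [pi_withDensity _ (fun _ => by fun_prop), lintegral_withDensity_eq_lintegral_mul _
    (by fun_prop) hF, ← Measure.restrict_pi_pi, ← volume_pi]
  simp_rw [Pi.mul_apply, mul_comm]

end

section

open Finset

/-! ### Densities of sums of independent positive variables -/

/-- Lebesgue measure on `(0, ∞)`. -/
def halfLine : Measure ℝ := volume.restrict (Set.Ioi 0)

instance : SFinite halfLine := inferInstanceAs (SFinite (volume.restrict _))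

instance : SigmaFinite halfLine := inferInstanceAs (SigmaFinite (volume.restrict _))

/-- Tonelli and the translation `r = a + s`. The function `G` is the integrand extended by zero off
the triangle `0 < s < r`, so that translation invariance on the whole line applies. -/
theorem lintegral_halfLine_conv {w φ : ℝ → ℝ} (hw : Continuous w) (hφ : Continuous φ)
    (hw0 : ∀ t, 0 < t → 0 ≤ w t) (hφ0 : ∀ t, 0 < t → 0 ≤ φ t) {F : ℝ → ENNReal}
    (hF : Measurable F) :
    ∫⁻ a, ∫⁻ s, F (a + s) * (ENNReal.ofReal (w a) * ENNReal.ofReal (φ s)) ∂halfLine ∂halfLine =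
      ∫⁻ r, F r * ENNReal.ofReal (∫ s in (0 : ℝ)..r, w (r - s) * φ s) ∂halfLine := by
  have hwm := hw.measurable
  have hφm := hφ.measurable
  rw [lintegral_lintegral_swap (by fun_prop)]
  set G : ℝ → ℝ → ENNReal := fun s r => if 0 < s ∧ s < r then
    F r * (ENNReal.ofReal (w (r - s)) * ENNReal.ofReal (φ s)) else 0 with hG
  have hGm : Measurable (Function.uncurry G) := by
    refine Measurable.ite ?_ (by fun_prop) measurable_const
    exact (measurableSet_lt measurable_const measurable_fst).inter
      (measurableSet_lt measurable_fst measurable_snd)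
  have h1 : ∀ s, (Set.Ioi (0 : ℝ)).indicator (fun s => ∫⁻ a, F (a + s) *
      (ENNReal.ofReal (w a) * ENNReal.ofReal (φ s)) ∂halfLine) s = ∫⁻ r, G s r := by
    intro s
    by_cases hs : 0 < s
    · rw [Set.indicator_of_mem (Set.mem_Ioi.2 hs), halfLine,
        ← lintegral_indicator measurableSet_Ioi, ← lintegral_add_right_eq_self (μ := volume) (G s) s]
      refine lintegral_congr fun a => ?_
      by_cases ha : 0 < a
      · rw [Set.indicator_of_mem (Set.mem_Ioi.2 ha)]
        simp [hG, hs, ha]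
      · rw [Set.indicator_of_notMem (by simpa using ha)]
        simp [hG, ha]
    · rw [Set.indicator_of_notMem (by simpa using hs)]
      simp [hG, hs]
  conv_lhs => rw [halfLine]
  rw [← lintegral_indicator measurableSet_Ioi]
  change ∫⁻ s, (Set.Ioi (0 : ℝ)).indicator (fun s => ∫⁻ a, F (a + s) *
      (ENNReal.ofReal (w a) * ENNReal.ofReal (φ s)) ∂halfLine) s = _
  simp_rw [h1]
  rw [lintegral_lintegral_swap hGm.aemeasurable, halfLine, ← lintegral_indicator measurableSet_Ioi]
  refine lintegral_congr fun r => ?_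
  by_cases hr : 0 < r
  · have hcont : Continuous fun s => w (r - s) * φ s := by fun_prop
    rw [Set.indicator_of_mem (Set.mem_Ioi.2 hr), intervalIntegral.integral_of_le hr.le,
      integral_Ioc_eq_integral_Ioo, ofReal_integral_eq_lintegral_ofReal
        (hcont.integrableOn_Icc.mono_set Set.Ioo_subset_Icc_self)
        ((ae_restrict_iff' measurableSet_Ioo).2 (Filter.Eventually.of_forall fun s hs =>
          mul_nonneg (hw0 _ (sub_pos.2 hs.2)) (hφ0 _ hs.1))),
      ← lintegral_const_mul _ (by fun_prop), ← lintegral_indicator measurableSet_Ioo]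
    refine lintegral_congr fun s => ?_
    by_cases hs : 0 < s ∧ s < r
    · rw [Set.indicator_of_mem (Set.mem_Ioo.2 hs), ENNReal.ofReal_mul (hw0 _ (sub_pos.2 hs.2))]
      simp [hG, hs]
    · rw [Set.indicator_of_notMem (by simpa using hs)]
      simp only [hG, if_neg hs]
  · rw [Set.indicator_of_notMem (by simpa using hr)]
    have : ∀ s, G s r = 0 := fun s => if_neg fun h => hr (h.1.trans h.2)
    simp [this]

/-- If the `t_i > 0` have the joint density `∏ w_i (t_i)`, then `Φ` is a density of `∑ t_i`. -/
def HasSumDensity {m : ℕ} (w : Fin m → ℝ → ℝ) (Φ : ℝ → ℝ) : Prop :=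
  ∀ F : ℝ → ENNReal, Measurable F →
    ∫⁻ t, F (∑ i, t i) * ∏ i, ENNReal.ofReal (w i (t i)) ∂(Measure.pi fun _ => halfLine) =
      ∫⁻ r, F r * ENNReal.ofReal (Φ r) ∂halfLine

theorem hasSumDensity_one (w : Fin 1 → ℝ → ℝ) (hw : Continuous (w 0)) :
    HasSumDensity w (w 0) := by
  intro F hF
  have hwm := hw.measurable
  simp only [Fin.sum_univ_one, Fin.prod_univ_one]
  rw [lintegral_pi_insertNth _ 0 (by fun_prop)]
  simp

theorem HasSumDensity.congr {m : ℕ} {w : Fin m → ℝ → ℝ} {Φ Ψ : ℝ → ℝ} (h : HasSumDensity w Φ)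
    (hΨ : ∀ r, 0 < r → Φ r = Ψ r) : HasSumDensity w Ψ := by
  intro F hF
  rw [h F hF]
  exact setLIntegral_congr_fun measurableSet_Ioi fun r hr => by simp only [hΨ r hr]

theorem HasSumDensity.succ {m : ℕ} {w : Fin (m + 1) → ℝ → ℝ} {Φ : ℝ → ℝ}
    (h : HasSumDensity (fun i : Fin m => w i.succ) Φ) (hw : ∀ i, Continuous (w i))
    (hΦ : Continuous Φ) (hw0 : ∀ t, 0 < t → 0 ≤ w 0 t) (hΦ0 : ∀ t, 0 < t → 0 ≤ Φ t) :
    HasSumDensity w fun r => ∫ s in (0 : ℝ)..r, w 0 (r - s) * Φ s := by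
  intro F hF
  have hwm := fun i => (hw i).measurable
  have hΦm := hΦ.measurable
  rw [← lintegral_halfLine_conv (hw 0) hΦ hw0 hΦ0 hF, lintegral_pi_insertNth _ 0 (by fun_prop)]
  refine lintegral_congr fun a => ?_
  simp_rw [Fin.insertNth_zero', Fin.sum_univ_succ, Fin.prod_univ_succ, Fin.cons_zero,
    Fin.cons_succ]
  have h' := h (fun r => F (a + r) * ENNReal.ofReal (w 0 a)) (by fun_prop)
  simp_rw [mul_assoc] at h'
  exact h'

/-- The sum of `m + 1` independent standard exponential variables has a Gamma law. -/
theorem hasSumDensity_exp_neg (m : ℕ) :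
    HasSumDensity (fun (_ : Fin (m + 1)) t => Real.exp (-t))
      fun r => r ^ m / (m.factorial : ℝ) * Real.exp (-r) := by
  induction m with
  | zero =>
    exact (hasSumDensity_one _ (by fun_prop)).congr fun r _ => by simp
  | succ m ih =>
    refine (HasSumDensity.succ (w := fun _ t => Real.exp (-t)) ih (fun _ => by fun_prop)
      (by fun_prop) (fun t _ => (Real.exp_pos _).le) fun t ht => by positivity).congr ?_
    intro r _
    have h : ∀ s, Real.exp (-(r - s)) * (s ^ m / (m.factorial : ℝ) * Real.exp (-s)) =
        s ^ m * (Real.exp (-r) / (m.factorial : ℝ)) := fun s => by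
      rw [show -r = -(r - s) + -s by ring, Real.exp_add]
      ring
    simp_rw [h]
    rw [intervalIntegral.integral_mul_const, integral_pow, Nat.factorial_succ]
    have := Nat.factorial_pos m
    push_cast
    field_simp
    simp

/-- Partial fractions, read off from the barycentric form of the interpolant of the constant `1`. -/
theorem sum_nodalWeight_mul_inv_sub {m : ℕ} {y : Fin (m + 1) → ℝ} (hy : Function.Injective y)
    {z : ℝ} (hz : ∀ i, z ≠ y i) :
    ∑ i, Lagrange.nodalWeight univ y i * (z - y i)⁻¹ = ∏ i, (z - y i)⁻¹ := by
  have h := Lagrange.eval_interpolate_not_at_node (s := univ) (v := y) 1 fun i _ => hz i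
  rw [Lagrange.interpolate_one hy.injOn univ_nonempty, Polynomial.eval_one,
    Lagrange.eval_nodal] at h
  simp only [Pi.one_apply, mul_one] at h
  rw [prod_inv_distrib]
  exact eq_inv_of_mul_eq_one_right h.symm

theorem nodalWeight_zero {m : ℕ} (y : Fin (m + 1) → ℝ) :
    Lagrange.nodalWeight univ y 0 = ∏ i : Fin m, (y 0 - y i.succ)⁻¹ := by
  have h : (univ : Finset (Fin (m + 1))).erase 0 = univ.map (Fin.succEmb m) := by
    ext i
    simp [Fin.exists_succ_eq]
  rw [Lagrange.nodalWeight, h, prod_map]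
  rfl

theorem nodalWeight_succ {m : ℕ} (y : Fin (m + 1) → ℝ) (j : Fin m) :
    Lagrange.nodalWeight univ y j.succ =
      Lagrange.nodalWeight univ (fun i => y i.succ) j * (y j.succ - y 0)⁻¹ := by
  have h : (univ : Finset (Fin (m + 1))).erase j.succ =
      insert 0 ((univ.erase j).map (Fin.succEmb m)) := by
    ext i
    refine Fin.cases ?_ (fun i => ?_) i
    · simp [(Fin.succ_ne_zero j).symm]
    · simp [Fin.succ_ne_zero]
  rw [Lagrange.nodalWeight, h, prod_insert (by simp [Fin.succ_ne_zero]), prod_map, mul_comm]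
  rfl

/-- The Hermite–Genocchi formula: divided differences of `exp` as a simplex integral. -/
theorem hasSumDensity_exp_mul {m : ℕ} {y : Fin (m + 1) → ℝ} (hy : Function.Injective y) :
    HasSumDensity (fun i t => Real.exp (y i * t))
      (fun r => ∑ j, Real.exp (y j * r) * Lagrange.nodalWeight univ y j) ∧
    ∀ r, 0 < r → 0 ≤ ∑ j, Real.exp (y j * r) * Lagrange.nodalWeight univ y j := by
  induction m with
  | zero =>
    refine ⟨(hasSumDensity_one _ (by fun_prop)).congr fun r _ => ?_, fun r _ => ?_⟩
    · simp [Lagrange.nodalWeight]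
    · simp [Lagrange.nodalWeight, Real.exp_nonneg]
  | succ m ih =>
    have hy' : Function.Injective fun i : Fin (m + 1) => y i.succ :=
      hy.comp (Fin.succ_injective _)
    obtain ⟨ih1, ih2⟩ := ih hy'
    -- Convolving with `exp (y 0 ·)` adds the node `y 0`. The upper limits produce the terms of the
    -- old nodes with updated weights; the lower limits sum, by partial fractions, to the term of `y
    -- 0`.
    have hint : ∀ r, ∫ s in (0 : ℝ)..r, Real.exp (y 0 * (r - s)) *
        ∑ j : Fin (m + 1), Real.exp (y j.succ * s) *
          Lagrange.nodalWeight univ (fun i : Fin (m + 1) => y i.succ) j =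
        ∑ j, Real.exp (y j * r) * Lagrange.nodalWeight univ y j := by
      intro r
      have hd : ∀ j : Fin (m + 1), y j.succ - y 0 ≠ 0 := fun j =>
        sub_ne_zero.2 fun h => Fin.succ_ne_zero j (hy h)
      have h1 : ∀ s, Real.exp (y 0 * (r - s)) *
          ∑ j : Fin (m + 1), Real.exp (y j.succ * s) *
            Lagrange.nodalWeight univ (fun i : Fin (m + 1) => y i.succ) j =
          ∑ j : Fin (m + 1), Real.exp ((y j.succ - y 0) * s) * (Real.exp (y 0 * r) *
            Lagrange.nodalWeight univ (fun i : Fin (m + 1) => y i.succ) j) := by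
        intro s
        rw [mul_sum]
        refine sum_congr rfl fun j _ => ?_
        rw [← mul_assoc, ← mul_assoc, ← Real.exp_add, ← Real.exp_add]
        ring_nf
      simp_rw [h1]
      rw [intervalIntegral.integral_finsetSum fun j _ => Continuous.intervalIntegrable
        (by fun_prop) _ _]
      have h2 : ∀ j : Fin (m + 1), ∫ s in (0 : ℝ)..r, Real.exp ((y j.succ - y 0) * s) *
          (Real.exp (y 0 * r) *
            Lagrange.nodalWeight univ (fun i : Fin (m + 1) => y i.succ) j) =
          Real.exp (y j.succ * r) * Lagrange.nodalWeight univ y j.succ +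
          Real.exp (y 0 * r) * (Lagrange.nodalWeight univ (fun i : Fin (m + 1) => y i.succ) j *
            (y 0 - y j.succ)⁻¹) := by
        intro j
        rw [intervalIntegral.integral_mul_const,
          intervalIntegral.integral_comp_mul_left (fun s => Real.exp s) (hd j), integral_exp,
          nodalWeight_succ, smul_eq_mul, mul_zero, Real.exp_zero,
          show y j.succ * r = (y j.succ - y 0) * r + y 0 * r by ring, Real.exp_add,
          ← neg_sub (y j.succ) (y 0), inv_neg]
        ring
      simp_rw [h2]
      rw [sum_add_distrib, ← mul_sum, sum_nodalWeight_mul_inv_sub hy'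
        (fun i h => Fin.succ_ne_zero i (hy h.symm)), ← nodalWeight_zero,
        Fin.sum_univ_succ (n := m + 1), add_comm]
    refine ⟨(HasSumDensity.succ (w := fun i t => Real.exp (y i * t)) ih1
      (fun i => by fun_prop) (by fun_prop) (fun t _ => (Real.exp_pos _).le) ih2).congr
        fun r _ => hint r, fun r hr => ?_⟩
    -- The nodal weights have mixed signs, so nonnegativity is read off from the convolution
    -- integral instead of the sum.
    rw [← hint r]
    rw [intervalIntegral.integral_of_le hr.le]
    exact setIntegral_nonneg measurableSet_Ioc fun s hs =>
      mul_nonneg (Real.exp_pos _).le (ih2 s hs.1)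

end

section

open Finset

/-! ### The unitary integral -/

theorem nodalWeight_sub_const {m : ℕ} (y : Fin m → ℝ) (a : ℝ) (j : Fin m) :
    Lagrange.nodalWeight univ (fun i => y i - a) j = Lagrange.nodalWeight univ y j := by
  simp [Lagrange.nodalWeight]

theorem nodalWeight_const_mul {m : ℕ} (y : Fin (m + 1) → ℝ) (a : ℝ) (j : Fin (m + 1)) :
    Lagrange.nodalWeight univ (fun i => a * y i) j =
      (a ^ m)⁻¹ * Lagrange.nodalWeight univ y j := by
  simp [Lagrange.nodalWeight, ← mul_sub, prod_mul_distrib, card_erase_of_mem, mul_comm]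

instance unitaryHaar_isProbabilityMeasure (N : ℕ) : IsProbabilityMeasure (unitaryHaar N) :=
  ⟨Measure.haarMeasure_self⟩

instance unitaryHaar_isMulLeftInvariant (N : ℕ) : (unitaryHaar N).IsMulLeftInvariant :=
  inferInstanceAs (Measure.haarMeasure _).IsMulLeftInvariant

/-- The entries of a unitary matrix. -/
def unitaryEntry {N : ℕ} (U : Matrix.unitaryGroup (Fin N) ℂ) (i j : Fin N) : ℂ :=
  (U : Matrix (Fin N) (Fin N) ℂ) i j

@[fun_prop]
theorem continuous_unitaryEntry {N : ℕ} (i j : Fin N) :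
    Continuous fun U : Matrix.unitaryGroup (Fin N) ℂ => unitaryEntry U i j :=
  (continuous_subtype_val).matrix_elem i j

@[fun_prop]
theorem measurable_unitaryEntry {N : ℕ} (i j : Fin N) :
    Measurable fun U : Matrix.unitaryGroup (Fin N) ℂ => unitaryEntry U i j :=
  (continuous_unitaryEntry i j).measurable

/-- Every vector is a multiple of the first row of a unitary matrix. -/
theorem exists_unitary_row {m : ℕ} (z : Fin (m + 1) → ℂ) :
    ∃ V : Matrix.unitaryGroup (Fin (m + 1)) ℂ, ∀ j,
      z j = ((√(∑ i, ‖z i‖ ^ 2) : ℝ) : ℂ) * unitaryEntry V 0 j := by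
  set e : EuclideanSpace ℂ (Fin (m + 1)) := WithLp.toLp 2 z with he
  have hnorm : ‖e‖ = √(∑ i, ‖z i‖ ^ 2) := EuclideanSpace.norm_eq e
  by_cases h0 : e = 0
  · refine ⟨1, fun j => ?_⟩
    rw [← hnorm, h0]
    have : z j = e j := rfl
    rw [this, h0]
    simp
  have hn0 : ‖e‖ ≠ 0 := norm_ne_zero_iff.2 h0
  set u : EuclideanSpace ℂ (Fin (m + 1)) := ((‖e‖ : ℂ)⁻¹) • e with hu
  have hu1 : ‖u‖ = 1 := by
    rw [hu, norm_smul, norm_inv, Complex.norm_real, norm_norm, inv_mul_cancel₀ hn0]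
  obtain ⟨b, hb⟩ := Orthonormal.exists_orthonormalBasis_extension_of_card_eq (𝕜 := ℂ)
    (E := EuclideanSpace ℂ (Fin (m + 1))) (ι := Fin (m + 1)) (by simp)
    (v := fun _ => u) (s := {0}) (by
      constructor
      · intro i
        exact hu1
      · intro i j hij
        exact absurd (Subsingleton.elim i j) hij)
  have hV : (Matrix.of fun i j => b i j) ∈ Matrix.unitaryGroup (Fin (m + 1)) ℂ := by
    rw [Matrix.mem_unitaryGroup_iff]
    ext i j
    have h := (orthonormal_iff_ite.1 b.orthonormal) j i
    rw [EuclideanSpace.inner_eq_star_dotProduct] at h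
    rw [Matrix.mul_apply, Matrix.one_apply]
    simp only [eq_comm (a := i)]
    rw [← h]
    rfl
  refine ⟨⟨_, hV⟩, fun j => ?_⟩
  rw [← hnorm]
  change z j = (‖e‖ : ℂ) * b 0 j
  rw [hb 0 rfl, hu]
  have : z j = e j := rfl
  rw [this]
  simp only [PiLp.smul_apply, smul_eq_mul]
  rw [mul_inv_cancel_left₀ (by exact_mod_cast hn0)]

/-- The Laplace transform of the squared first row of a Haar unitary matrix. -/
def rowIntegral {m : ℕ} (y : Fin (m + 1) → ℝ) (r : ℝ) : ℝ :=
  ∫ U : Matrix.unitaryGroup (Fin (m + 1)) ℂ,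
    Real.exp (r * ∑ j, y j * ‖unitaryEntry U 0 j‖ ^ 2)
      ∂(unitaryHaar (m + 1))

theorem continuous_rowIntegral {m : ℕ} (y : Fin (m + 1) → ℝ) : Continuous (rowIntegral y) := by
  have h : Continuous (Function.uncurry fun (r : ℝ) (U : Matrix.unitaryGroup (Fin (m + 1)) ℂ) =>
      Real.exp (r * ∑ j, y j * ‖unitaryEntry U 0 j‖ ^ 2)) := by
    fun_prop
  have h' := continuous_parametric_integral_of_continuous (μ := unitaryHaar (m + 1)) h
    isCompact_univ
  simp only [Measure.restrict_univ] at h'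
  exact h'

theorem ofReal_rowIntegral {m : ℕ} (y : Fin (m + 1) → ℝ) (r : ℝ) :
    ENNReal.ofReal (rowIntegral y r) = ∫⁻ U : Matrix.unitaryGroup (Fin (m + 1)) ℂ,
      ENNReal.ofReal (Real.exp (r *
        ∑ j, y j * ‖unitaryEntry U 0 j‖ ^ 2))
          ∂(unitaryHaar (m + 1)) := by
  rw [rowIntegral, ofReal_integral_eq_lintegral_ofReal]
  · exact Continuous.integrable_of_hasCompactSupport (by fun_prop)
      (HasCompactSupport.of_compactSpace _)
  · exact Filter.Eventually.of_forall fun U => (Real.exp_pos _).le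

/-- Averaging over a random rotation of `z` changes nothing on the left. For fixed `z` the rotated
vector is `‖z‖` times the first row of a Haar unitary, whatever the direction of `z`, so only the
norm survives. -/
theorem lintegral_gaussianVector_exp {m : ℕ} (y : Fin (m + 1) → ℝ) {F : ℝ → ENNReal}
    (hF : Measurable F) :
    ∫⁻ z, F (∑ j, ‖z j‖ ^ 2) * ENNReal.ofReal (Real.exp (∑ j, y j * ‖z j‖ ^ 2))
      ∂gaussianVector (m + 1) =
    ∫⁻ z, F (∑ j, ‖z j‖ ^ 2) * ENNReal.ofReal (rowIntegral y (∑ j, ‖z j‖ ^ 2))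
      ∂gaussianVector (m + 1) := by
  have hU : ∀ U : Matrix.unitaryGroup (Fin (m + 1)) ℂ,
      ∫⁻ z, F (∑ j, ‖z j‖ ^ 2) * ENNReal.ofReal (Real.exp (∑ j, y j * ‖z j‖ ^ 2))
        ∂gaussianVector (m + 1) =
      ∫⁻ z, F (∑ j, ‖z j‖ ^ 2) * ENNReal.ofReal (Real.exp (∑ j, y j *
        ‖∑ i, unitaryEntry U i j * z i‖ ^ 2))
        ∂gaussianVector (m + 1) := by
    intro U
    -- The transpose is used so that `z` multiplies `U` from the left as a row vector; writing `z`
    -- as a multiple of the first row of `V` then leads to `V * U`, where left invariance applies.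
    have hT : ((U : Matrix (Fin (m + 1)) (Fin (m + 1)) ℂ).transpose).conjTranspose *
        (U : Matrix (Fin (m + 1)) (Fin (m + 1)) ℂ).transpose = 1 := by
      have h := Matrix.mem_unitaryGroup_iff.1 U.2
      rw [← Matrix.transpose_one, ← h, Matrix.transpose_mul, Matrix.star_eq_conjTranspose]
      rfl
    conv_lhs => rw [← map_mulVec_gaussianVector hT]
    have hc : Continuous fun z : Fin (m + 1) → ℂ =>
        (U : Matrix (Fin (m + 1)) (Fin (m + 1)) ℂ).transpose.mulVec z :=
      Continuous.matrix_mulVec continuous_const continuous_id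
    have hg : Measurable fun z : Fin (m + 1) → ℂ => F (∑ j, ‖z j‖ ^ 2) *
        ENNReal.ofReal (Real.exp (∑ j, y j * ‖z j‖ ^ 2)) := by fun_prop
    rw [lintegral_map hg hc.measurable]
    refine lintegral_congr fun z => ?_
    rw [sum_sq_norm_mulVec_of_unitary hT]
    rfl
  calc _ = ∫⁻ _U : Matrix.unitaryGroup (Fin (m + 1)) ℂ, (∫⁻ z, F (∑ j, ‖z j‖ ^ 2) *
        ENNReal.ofReal (Real.exp (∑ j, y j * ‖z j‖ ^ 2)) ∂gaussianVector (m + 1))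
          ∂(unitaryHaar (m + 1)) := by rw [lintegral_const, measure_univ, mul_one]
    _ = _ := lintegral_congr hU
    _ = _ := lintegral_lintegral_swap (by fun_prop)
    _ = _ := ?_
  refine lintegral_congr fun z => ?_
  rw [lintegral_const_mul _ (by fun_prop)]
  congr 1
  obtain ⟨V, hV⟩ := exists_unitary_row z
  rw [ofReal_rowIntegral]
  refine (lintegral_congr fun U => ?_).trans (lintegral_mul_left_eq_self _ V)
  congr 2
  rw [mul_sum]
  refine sum_congr rfl fun j _ => ?_
  have h0 : 0 ≤ ∑ i, ‖z i‖ ^ 2 := by positivity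
  have h : ∑ i, unitaryEntry U i j * z i =
      ((√(∑ i, ‖z i‖ ^ 2) : ℝ) : ℂ) *
        unitaryEntry (V * U) 0 j := by
    rw [unitaryEntry, Submonoid.coe_mul, Matrix.mul_apply, mul_sum]
    refine sum_congr rfl fun i _ => ?_
    conv_lhs => rw [hV i]
    simp only [unitaryEntry]
    ring
  rw [h, norm_mul, mul_pow, Complex.norm_real, Real.norm_eq_abs, sq_abs, Real.sq_sqrt h0]
  ring

theorem lintegral_gaussianVector_sq_norm {n : ℕ} {H : (Fin n → ℝ) → ENNReal} (hH : Measurable H) :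
    ∫⁻ z, H (fun i => ‖z i‖ ^ 2) ∂gaussianVector n =
      ∫⁻ t, H t * ∏ i, ENNReal.ofReal (Real.exp (-t i)) ∂(Measure.pi fun _ => halfLine) := by
  have h := lintegral_map (μ := gaussianVector n) (f := H) (g := fun z i => ‖z i‖ ^ 2) hH
    (by fun_prop)
  rw [← h, map_sq_norm_gaussianVector, lintegral_pi_expLaw hH, volume_pi, Measure.restrict_pi_pi]
  rfl

/-- The rank one Harish-Chandra–Itzykson–Zuber integral. -/
theorem rowIntegral_one {m : ℕ} {y : Fin (m + 1) → ℝ} (hy : Function.Injective y) :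
    rowIntegral y 1 =
      (m.factorial : ℝ) * ∑ j, Real.exp (y j) * Lagrange.nodalWeight univ y j := by
  -- The law of `|z_j|²` contributes `exp (-t)`, which shifts the rates to `y j - 1`; the nodal
  -- weights are unchanged by the shift.
  set Φ : ℝ → ℝ := fun r => ∑ j, Real.exp ((y j - 1) * r) * Lagrange.nodalWeight univ y j with hΦ
  have hy1 : Function.Injective fun j => y j - 1 := fun i j h => hy (by simpa using h)
  obtain ⟨hs, hΦ0⟩ := hasSumDensity_exp_mul hy1
  simp_rw [nodalWeight_sub_const] at hs hΦ0
  have hJm := (continuous_rowIntegral y).measurable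
  have key : ∀ F : ℝ → ENNReal, Measurable F →
      ∫⁻ r, F r * ENNReal.ofReal (Φ r) ∂halfLine =
      ∫⁻ r, F r * ENNReal.ofReal (rowIntegral y r) *
        ENNReal.ofReal (r ^ m / (m.factorial : ℝ) * Real.exp (-r)) ∂halfLine := by
    intro F hF
    rw [← hs F hF, ← hasSumDensity_exp_neg m (fun r => F r * ENNReal.ofReal (rowIntegral y r))
      (by fun_prop), ← lintegral_gaussianVector_sq_norm (n := m + 1) (H := fun t =>
        F (∑ i, t i) * ENNReal.ofReal (rowIntegral y (∑ i, t i))) (by fun_prop),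
      ← lintegral_gaussianVector_exp y hF, lintegral_gaussianVector_sq_norm (n := m + 1)
        (H := fun t => F (∑ i, t i) * ENNReal.ofReal (Real.exp (∑ i, y i * t i))) (by fun_prop)]
    refine lintegral_congr fun t => ?_
    rw [mul_assoc, Real.exp_sum, ENNReal.ofReal_prod_of_nonneg fun i _ => (Real.exp_pos _).le,
      ← prod_mul_distrib]
    congr 1
    refine prod_congr rfl fun i _ => ?_
    rw [← ENNReal.ofReal_mul (Real.exp_pos _).le, ← Real.exp_add]
    ring_nf
  have hΦc : Continuous Φ := by fun_prop
  have hΦm := hΦc.measurable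
  have hae : (fun r => ENNReal.ofReal (Φ r)) =ᵐ[halfLine] fun r =>
      ENNReal.ofReal (rowIntegral y r) *
        ENNReal.ofReal (r ^ m / (m.factorial : ℝ) * Real.exp (-r)) := by
    refine ae_eq_of_forall_setLIntegral_eq_of_sigmaFinite (by fun_prop) (by fun_prop) ?_
    intro s hs _
    have h := key (s.indicator 1) (measurable_one.indicator hs)
    rw [← lintegral_indicator hs, ← lintegral_indicator hs]
    convert h using 2
    · funext r
      by_cases hr : r ∈ s <;> simp [hr]
    · funext r
      by_cases hr : r ∈ s <;> simp [hr]
  have hJ0 : ∀ r, 0 ≤ rowIntegral y r := fun r => integral_nonneg fun U => (Real.exp_pos _).le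
  have hae' : Φ =ᵐ[volume.restrict (Set.Ioi 0)] fun r =>
      rowIntegral y r * (r ^ m / (m.factorial : ℝ) * Real.exp (-r)) := by
    filter_upwards [hae, ae_restrict_mem measurableSet_Ioi] with r hr hr0
    have hr0' : 0 < r := hr0
    rw [← ENNReal.ofReal_mul (hJ0 r)] at hr
    exact (ENNReal.ofReal_eq_ofReal_iff (hΦ0 r hr0)
      (mul_nonneg (hJ0 r) (by positivity))).1 hr
  -- Almost everywhere equality of continuous functions on the open half line holds everywhere, in
  -- particular at `r = 1`.
  have heq := Measure.eqOn_open_of_ae_eq hae' isOpen_Ioi hΦc.continuousOn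
    (by have := continuous_rowIntegral y; fun_prop) (Set.mem_Ioi.2 one_pos)
  simp only [hΦ, mul_one, one_pow, Real.exp_sub, div_mul_eq_mul_div, ← sum_div] at heq
  rw [Real.exp_neg] at heq
  have hm := Nat.factorial_pos m
  field_simp at heq
  rw [← heq, mul_comm]

theorem inv_spike (N : ℕ) {b : ℝ} (hb : 0 < b) :
    (spike N b)⁻¹ = Matrix.diagonal fun i : Fin N => if (i : ℕ) = 0 then (b : ℂ)⁻¹ else 1 := by
  refine Matrix.inv_eq_left_inv ?_
  rw [spike, Matrix.diagonal_mul_diagonal, ← Matrix.diagonal_one]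
  congr 1
  funext i
  have : (b : ℂ) ≠ 0 := by exact_mod_cast hb.ne'
  split_ifs <;> simp [this]

/-- The only possibly nonzero entry of `Σ⁻¹ - 1` is `1 / b - 1` in the corner, so only the first row
of `U` contributes. -/
theorem neg_re_trace_eq {m : ℕ} {b : ℝ} (hb : 0 < b) (x : Fin (m + 1) → ℝ)
    (U : Matrix (Fin (m + 1)) (Fin (m + 1)) ℂ) :
    -(Matrix.trace (U * Matrix.diagonal (fun i => (x i : ℂ)) * U.conjTranspose *
      ((spike (m + 1) b)⁻¹ - 1))).re = ∑ j, (1 - 1 / b) * x j * ‖U 0 j‖ ^ 2 := by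
  have h1 : (spike (m + 1) b)⁻¹ - 1 =
      Matrix.diagonal (Pi.single 0 ((b : ℂ)⁻¹ - 1)) := by
    rw [inv_spike _ hb, ← Matrix.diagonal_one, Matrix.diagonal_sub]
    congr 1
    funext i
    refine Fin.cases ?_ (fun i => ?_) i <;> simp
  have h2 : ∀ j, U 0 j * x j * star (U 0 j) = ((x j * ‖U 0 j‖ ^ 2 : ℝ) : ℂ) := fun j => by
    rw [mul_right_comm, Complex.star_def, Complex.mul_conj']
    push_cast
    ring
  rw [h1, Matrix.trace]
  simp only [Matrix.diag_apply, Matrix.mul_diagonal]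
  rw [sum_eq_single 0 (fun i _ hi => by simp [hi]) (by simp), Pi.single_eq_same, Matrix.mul_apply]
  simp only [Matrix.mul_diagonal, Matrix.conjTranspose_apply, h2]
  rw [← Complex.ofReal_sum, ← Complex.ofReal_inv, ← Complex.ofReal_one, ← Complex.ofReal_sub,
    ← Complex.ofReal_mul, Complex.ofReal_re, sum_mul, ← sum_neg_distrib]
  refine sum_congr rfl fun j _ => ?_
  rw [one_div]
  ring

theorem det_spike {m : ℕ} (b : ℝ) : (spike (m + 1) b).det.re = b := by
  rw [spike, Matrix.det_diagonal, Fin.prod_univ_succ]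
  simp

/-- The coefficient relating the unitary integral form to the determinantal form. -/
def haarCoeff (N : ℕ) (b : ℝ) : ℝ :=
  √(1 / b) * (N - 1).factorial * ((1 - 1 / b) ^ (N - 1))⁻¹

theorem one_sub_one_div_ne_zero {b : ℝ} (hb : 0 < b) (hb1 : b ≠ 1) : 1 - 1 / b ≠ 0 := by
  intro h
  field_simp at h
  exact hb1 (by linarith)

theorem haarCoeff_ne_zero {N : ℕ} {b : ℝ} (hb : 0 < b) (hb1 : b ≠ 1 ∨ N = 1) :
    haarCoeff N b ≠ 0 := by
  refine mul_ne_zero (mul_ne_zero ?_ ?_) (inv_ne_zero ?_)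
  · exact (Real.sqrt_pos.2 (by positivity)).ne'
  · exact_mod_cast (Nat.factorial_pos _).ne'
  · rcases hb1 with h | rfl
    · exact pow_ne_zero _ (one_sub_one_div_ne_zero hb h)
    · simp

theorem haarForm_eq (n : ℕ) {N : ℕ} (hN : 1 ≤ N) {b : ℝ} (hb : 0 < b) (hb1 : b ≠ 1 ∨ N = 1)
    (x : Fin N → ℝ) : haarForm n N b x = haarCoeff N b * detForm n N b x := by
  obtain ⟨m, rfl⟩ : ∃ m, N = m + 1 := ⟨N - 1, by omega⟩
  by_cases hx : Function.Injective x
  · have hy : Function.Injective fun j => (1 - 1 / b) * x j := by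
      rcases hb1 with h | h
      · exact (mul_right_injective₀ (one_sub_one_div_ne_zero hb h)).comp hx
      -- Here `c` may vanish, but a single point is trivially injective.
      · obtain rfl : m = 0 := by omega
        intro i j _
        exact (Fin.eq_zero i).trans (Fin.eq_zero j).symm
    have hI := rowIntegral_one hy
    simp_rw [rowIntegral, one_mul, unitaryEntry, nodalWeight_const_mul] at hI
    rw [haarForm, detForm, det_borderedVandermonde hN _ hx, det_spike, haarCoeff]
    simp_rw [neg_re_trace_eq hb]
    rw [hI, Nat.add_sub_cancel]
    simp_rw [mul_left_comm (Real.exp _), ← mul_sum]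
    ring
  · have h0 : diffProd x = 0 := by
      by_contra h
      exact hx (diffProd_ne_zero_iff.1 h)
    simp [haarForm, detForm, h0]

end

section

open Finset Polynomial

/-! ### Increasing eigenvalue vectors -/

theorem exists_equiv_of_map_univ_eq {ι κ γ : Type*} [Fintype ι] [Fintype κ] [DecidableEq γ]
    {f : ι → γ} {g : κ → γ} (h : (univ : Finset ι).val.map f = (univ : Finset κ).val.map g) :
    ∃ e : ι ≃ κ, ∀ i, g (e i) = f i := by
  have hc : ∀ c, Nonempty ({a // f a = c} ≃ {b // g b = c}) := fun c => by
    refine ⟨Fintype.equivOfCardEq ?_⟩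
    have := congrArg (Multiset.count c) h
    rw [Multiset.count_map, Multiset.count_map] at this
    rw [Fintype.card_subtype, Fintype.card_subtype]
    simpa [Finset.card, Finset.filter, eq_comm] using this
  exact ⟨Equiv.ofFiberEquiv fun c => (hc c).some, fun i => Equiv.ofFiberEquiv_map _ i⟩

theorem eq_of_monotone_of_map_univ_eq {N : ℕ} {x y : Fin N → ℝ} (hx : Monotone x) (hy : Monotone y)
    (h : (univ : Finset (Fin N)).val.map x = (univ : Finset (Fin N)).val.map y) : x = y := by
  rw [Fin.univ_val_map, Fin.univ_val_map, Multiset.coe_eq_coe] at h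
  exact List.ofFn_injective (List.Perm.eq_of_sortedLE hx.sortedLE_ofFn hy.sortedLE_ofFn h)

theorem map_univ_eq_of_prod_X_sub_C_eq {ι κ R : Type*} [Fintype ι] [Fintype κ] [CommRing R]
    [IsDomain R] {x : ι → R} {y : κ → R} (h : ∏ i, (X - C (x i)) = ∏ i, (X - C (y i))) :
    (univ : Finset ι).val.map x = (univ : Finset κ).val.map y := by
  have hr : ∀ {ι : Type _} [Fintype ι] (x : ι → R),
      (∏ i, (X - C (x i))).roots = (univ : Finset ι).val.map x := fun x => by
    rw [← roots_multiset_prod_X_sub_C (univ.val.map x), Multiset.map_map]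
    rfl
  rw [← hr x, h]
  rw [← roots_multiset_prod_X_sub_C (univ.val.map y), Multiset.map_map]
  rfl

/-- The values at `0, …, N - 1` of the monic polynomial with roots `x`. -/
def rootValues {N : ℕ} (x : Fin N → ℝ) : Fin N → ℝ := fun m => ∏ i, ((m : ℕ) - x i)

/-- A monic polynomial of degree `N` is determined by `N` values, and its roots by their increasing
order. -/
theorem injOn_rootValues (N : ℕ) : Set.InjOn (rootValues (N := N)) {x | Monotone x} := by
  intro x hx y hy hxy
  refine eq_of_monotone_of_map_univ_eq hx hy (map_univ_eq_of_prod_X_sub_C_eq ?_)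
  change Lagrange.nodal univ x = Lagrange.nodal univ y
  refine Polynomial.eq_of_degree_sub_lt_of_eval_index_eq (v := fun m : Fin N => ((m : ℕ) : ℝ)) univ
    ?_ (degree_nodal_sub_nodal_lt x y) fun m _ => ?_
  · intro i _ j _ hij
    exact Fin.ext (Nat.cast_injective (R := ℝ) hij)
  · rw [Lagrange.eval_nodal, Lagrange.eval_nodal]
    exact congrFun hxy m

/-- A continuous injection on a closed subset of `ℝ^N` is a measurable embedding, so its inverse
extends to a measurable map. Measurability of the ordered eigenvalues thus needs no perturbation
theory. -/
theorem exists_measurable_sortedRoots (N : ℕ) : ∃ s : (Fin N → ℝ) → (Fin N → ℝ),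
    Measurable s ∧ ∀ x, Monotone x → s (rootValues x) = x := by
  have hS : MeasurableSet {x : Fin N → ℝ | Monotone x} := isClosed_monotone.measurableSet
  have hc : Continuous (rootValues (N := N)) := by
    unfold rootValues
    fun_prop
  obtain ⟨s, hs, h⟩ := (hc.continuousOn.measurableEmbedding hS
    (injOn_rootValues N)).exists_measurable_extend measurable_subtype_coe fun y => ⟨y⟩
  exact ⟨s, hs, fun x hx => congrFun h ⟨x, hx⟩⟩

/-- A measurable function recovering increasing real roots from values of a polynomial. -/
def sortedRoots (N : ℕ) : (Fin N → ℝ) → (Fin N → ℝ) := (exists_measurable_sortedRoots N).choose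

theorem measurable_sortedRoots (N : ℕ) : Measurable (sortedRoots N) :=
  (exists_measurable_sortedRoots N).choose_spec.1

theorem sortedRoots_rootValues {N : ℕ} {x : Fin N → ℝ} (hx : Monotone x) :
    sortedRoots N (rootValues x) = x :=
  (exists_measurable_sortedRoots N).choose_spec.2 x hx

/-- The eigenvalues of a Hermitian matrix in increasing order, as a measurable function. -/
def sortedEigenvalues {N : ℕ} (A : Matrix (Fin N) (Fin N) ℂ) : Fin N → ℝ :=
  sortedRoots N fun m => (A.charpoly.eval ((m : ℕ) : ℂ)).re

theorem sortedEigenvalues_congr {N : ℕ} {A B : Matrix (Fin N) (Fin N) ℂ}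
    (h : A.charpoly = B.charpoly) : sortedEigenvalues A = sortedEigenvalues B := by
  simp only [sortedEigenvalues, h]

theorem sortedEigenvalues_eq {N : ℕ} {A : Matrix (Fin N) (Fin N) ℂ} {x : Fin N → ℝ}
    (hx : Monotone x) (h : A.charpoly = ∏ i, (X - C (x i : ℂ))) : sortedEigenvalues A = x := by
  rw [sortedEigenvalues]
  conv_rhs => rw [← sortedRoots_rootValues hx]
  congr 1
  funext m
  rw [h, eval_prod, rootValues]
  simp only [eval_sub, eval_X, eval_C]
  have : ∏ i, (((m : ℕ) : ℂ) - (x i : ℂ)) = ((∏ i, (((m : ℕ) : ℝ) - x i) : ℝ) : ℂ) := by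
    push_cast
    rfl
  rw [this, Complex.ofReal_re]

theorem measurable_sortedEigenvalues {N : ℕ} {α : Type*} [TopologicalSpace α] [MeasurableSpace α]
    [OpensMeasurableSpace α] {f : α → Matrix (Fin N) (Fin N) ℂ} (hf : Continuous f) :
    Measurable fun a => sortedEigenvalues (f a) := by
  refine (measurable_sortedRoots N).comp (measurable_pi_lambda _ fun m => ?_)
  simp_rw [Matrix.eval_charpoly]
  exact (Complex.continuous_re.comp ((continuous_const.sub hf).matrix_det)).measurable

/-- Eigenvalues in Mathlib's order are a fixed rearrangement of the increasing ones. -/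
theorem exists_perm_eigenvalues_eq (N : ℕ) : ∃ ρ : Equiv.Perm (Fin N),
    ∀ (A : Matrix (Fin N) (Fin N) ℂ) (hA : A.IsHermitian),
      hA.eigenvalues = sortedEigenvalues A ∘ ρ := by
  set τ : Fin (Fintype.card (Fin N)) ≃ Fin N :=
    Fintype.equivOfCardEq (Fintype.card_fin _) with hτ
  -- `eigenvalues` is the decreasing list relabelled by the fixed bijection `τ`; `ρ` cancels the
  -- relabelling and reverses the order, independently of the matrix.
  set ρ : Equiv.Perm (Fin N) :=
    (Fin.revPerm.trans (finCongr (Fintype.card_fin N).symm)).trans τ with hρ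
  refine ⟨ρ.symm, fun A hA => ?_⟩
  have hmono : Monotone (hA.eigenvalues ∘ ρ) := by
    intro i j hij
    have h : ∀ k, (hA.eigenvalues ∘ ρ) k =
        hA.eigenvalues₀ (finCongr (Fintype.card_fin N).symm k.rev) := fun k => by
      simp only [Function.comp_apply, Matrix.IsHermitian.eigenvalues, hρ, Equiv.trans_apply,
        ← hτ, Equiv.symm_apply_apply, Fin.revPerm_apply]
    rw [h, h]
    exact hA.eigenvalues₀_antitone (Fin.rev_le_rev.2 hij)
  have hch : A.charpoly = ∏ i, (X - C (((hA.eigenvalues ∘ ρ) i : ℝ) : ℂ)) := by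
    rw [hA.charpoly_eq]
    exact (Equiv.prod_comp ρ fun i => X - C ((hA.eigenvalues i : ℝ) : ℂ)).symm
  rw [sortedEigenvalues_eq hmono hch]
  funext i
  simp

theorem charpoly_eq_prod_sortedEigenvalues {N : ℕ} {A : Matrix (Fin N) (Fin N) ℂ}
    (hA : A.IsHermitian) : A.charpoly = ∏ i, (X - C (sortedEigenvalues A i : ℂ)) := by
  obtain ⟨ρ, hρ⟩ := exists_perm_eigenvalues_eq N
  rw [hA.charpoly_eq]
  simp_rw [hρ A hA]
  exact Equiv.prod_comp ρ fun i => X - C ((sortedEigenvalues A i : ℝ) : ℂ)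

/-- Allows characteristic polynomials to be compared at large real `z` only, away from the poles of
the secular equation. -/
theorem eq_of_eventually_eval_ofReal_eq {p q : ℂ[X]}
    (h : ∀ᶠ z : ℝ in Filter.atTop, p.eval (z : ℂ) = q.eval (z : ℂ)) : p = q := by
  refine eq_of_infinite_eval_eq p q ?_
  obtain ⟨B, hB⟩ := Filter.eventually_atTop.1 h
  refine Set.Infinite.mono (s := (fun z : ℝ => (z : ℂ)) '' Set.Ici B) ?_
    ((Set.Ici_infinite B).image Complex.ofReal_injective.injOn)
  rintro _ ⟨z, hz, rfl⟩
  exact hB z hz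

/-! ### Rank one updates of the Wishart matrix -/

/-- The matrix with columns `Y k`. -/
def ofColumns {n N : ℕ} (Y : Fin N → Fin n → ℂ) : Matrix (Fin n) (Fin N) ℂ :=
  Matrix.of fun i k => Y k i

/-- The matrix `X Σ X†`, where `X` has columns `Y k`. -/
def outerWishart {n N : ℕ} (b : ℝ) (Y : Fin N → Fin n → ℂ) : Matrix (Fin n) (Fin n) ℂ :=
  ∑ k : Fin N, (if (k : ℕ) = 0 then (b : ℂ) else 1) • Matrix.vecMulVec (Y k) (star (Y k))

theorem outerWishart_eq {n N : ℕ} {b : ℝ} (hb : 0 < b) (Y : Fin N → Fin n → ℂ) :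
    outerWishart b Y =
      (ofColumns Y * spikeSqrt N b) * (spikeSqrt N b * (ofColumns Y).conjTranspose) := by
  rw [Matrix.mul_assoc, ← Matrix.mul_assoc (spikeSqrt N b), (spikeSqrt_spec N hb).2]
  ext i j
  rw [outerWishart, Matrix.sum_apply, spike, Matrix.mul_apply]
  refine sum_congr rfl fun k _ => ?_
  simp [ofColumns, Matrix.vecMulVec_apply, Matrix.diagonal_mul]
  split_ifs <;> ring

/-- The two matrices are `A B` and `B A`. The outer one has a size independent of the number of
columns, so columns can be appended additively. -/
theorem charpoly_outerWishart {n N : ℕ} (hNn : N ≤ n) {b : ℝ} (hb : 0 < b)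
    (Y : Fin N → Fin n → ℂ) :
    (outerWishart b Y).charpoly = X ^ (n - N) * (wishart b (ofColumns Y)).charpoly := by
  rw [outerWishart_eq hb, Matrix.charpoly_mul_comm_of_le _ _ (by simpa using hNn), wishart]
  simp [Matrix.mul_assoc]

theorem outerWishart_isHermitian {n N : ℕ} (b : ℝ) (Y : Fin N → Fin n → ℂ) :
    (outerWishart b Y).IsHermitian := by
  rw [outerWishart, Matrix.IsHermitian, Matrix.conjTranspose_sum]
  refine sum_congr rfl fun k _ => ?_
  rw [Matrix.conjTranspose_smul, Matrix.conjTranspose_vecMulVec, star_star]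
  congr 1
  split_ifs <;> simp

theorem outerWishart_snoc {n N : ℕ} (hN : 1 ≤ N) (b : ℝ) (Y : Fin N → Fin n → ℂ)
    (v : Fin n → ℂ) :
    outerWishart b (Fin.snoc Y v : Fin (N + 1) → Fin n → ℂ) =
      outerWishart b Y + Matrix.vecMulVec v (star v) := by
  rw [outerWishart, Fin.sum_univ_castSucc, outerWishart]
  -- The new column has index `N ≠ 0`, so it carries weight `1` and not `b`.
  have hN0 : N ≠ 0 := by omega
  simp [Fin.snoc_castSucc, Fin.snoc_last, hN0]

theorem continuous_wishart_ofColumns {n N : ℕ} (b : ℝ) {α : Type*} [TopologicalSpace α]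
    {f : α → Fin N → Fin n → ℂ} (hf : Continuous f) :
    Continuous fun a => wishart b (ofColumns (f a)) := by
  have h : Continuous fun a => ofColumns (f a) :=
    continuous_matrix fun i k => by
      change Continuous fun a => f a k i
      fun_prop
  exact ((continuous_const.matrix_mul h.matrix_conjTranspose).matrix_mul h).matrix_mul
    continuous_const

/-- The characteristic polynomial of a rank one perturbation of a diagonal matrix. -/
theorem det_sub_diagonal_sub_vecMulVec {ι : Type*} [Fintype ι] [DecidableEq ι] (d : ι → ℝ)
    (w : ι → ℂ) {z : ℝ} (hz : ∀ i, z ≠ d i) :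
    (Matrix.scalar ι (z : ℂ) - Matrix.diagonal (fun i => (d i : ℂ)) -
      Matrix.vecMulVec w (star w)).det =
      (((∏ i, (z - d i)) * (1 - ∑ i, ‖w i‖ ^ 2 / (z - d i)) : ℝ) : ℂ) := by
  have hz' : ∀ i, (z : ℂ) - d i ≠ 0 := fun i => by
    rw [← Complex.ofReal_sub]
    exact_mod_cast sub_ne_zero.2 (hz i)
  have h : Matrix.scalar ι (z : ℂ) - Matrix.diagonal (fun i => (d i : ℂ)) -
      Matrix.vecMulVec w (star w) = Matrix.diagonal (fun i => (z : ℂ) - d i) *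
        (1 + Matrix.replicateCol Unit (fun i => -(w i / ((z : ℂ) - d i))) *
          Matrix.replicateRow Unit (star w)) := by
    ext i j
    rw [Matrix.mul_add, Matrix.mul_one, ← Matrix.vecMulVec_eq, Matrix.add_apply,
      Matrix.diagonal_mul, Matrix.vecMulVec_apply, Matrix.sub_apply, Matrix.sub_apply,
      Matrix.vecMulVec_apply, Matrix.scalar_apply]
    by_cases hij : i = j
    · subst hij
      have := hz' i
      simp only [Matrix.diagonal_apply_eq]
      field_simp
      ring
    · have := hz' i
      simp only [Matrix.diagonal_apply_ne _ hij]
      field_simp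
      ring
  rw [h, Matrix.det_mul, Matrix.det_diagonal, Matrix.det_one_add_replicateCol_mul_replicateRow]
  push_cast
  congr 1
  rw [dotProduct, sub_eq_add_neg, ← sum_neg_distrib]
  congr 1
  refine sum_congr rfl fun i _ => ?_
  rw [Pi.star_apply, Complex.star_def, ← Complex.conj_mul']
  ring

end

section

open Finset Polynomial

theorem sum_mul_prod_erase_eq {ι : Type*} [Fintype ι] [DecidableEq ι] (q g : ι → ℝ)
    (hg : ∀ i, g i ≠ 0) : ∑ j, q j * ∏ i ∈ univ.erase j, g i = (∏ i, g i) * ∑ j, q j / g j := by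
  rw [mul_sum]
  refine sum_congr rfl fun j _ => ?_
  rw [← mul_prod_erase univ g (mem_univ j)]
  have := hg j
  field_simp

/-- `U` diagonalises the old outer matrix and `e` separates its `N` Wishart eigenvalues from `m + 1`
further zeros. The new column enters only through its squared coordinates, and those along the zeros
merge into a single weight at the pole `0`. Both `U` and `e` depend on `Y` alone. -/
theorem exists_unitary_charpoly_update {n N m : ℕ} (hn : n = N + m + 1) (hN : 1 ≤ N) {b : ℝ}
    (hb : 0 < b) (Y : Fin N → Fin n → ℂ) :
    ∃ (U : Matrix (Fin n) (Fin n) ℂ) (e : Fin N ⊕ Fin (m + 1) ≃ Fin n),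
      U.conjTranspose * U = 1 ∧ ∀ (w : Fin n → ℂ) (α q : Fin (N + 1) → ℝ),
        α = Fin.cons 0 (sortedEigenvalues (wishart b (ofColumns Y))) →
        q = Fin.cons (∑ j, ‖w (e (Sum.inr j))‖ ^ 2) (fun j => ‖w (e (Sum.inl j))‖ ^ 2) →
        ∀ᶠ z : ℝ in Filter.atTop,
          (wishart b (ofColumns (Fin.snoc Y (U.mulVec w) :
            Fin (N + 1) → Fin n → ℂ))).charpoly.eval (z : ℂ) =
          ((∏ i, (z - α i) - ∑ j, q j * ∏ i ∈ univ.erase j, (z - α i) : ℝ) : ℂ) := by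
  set M := outerWishart b Y with hM
  have hMh : M.IsHermitian := outerWishart_isHermitian b Y
  set a := sortedEigenvalues (wishart b (ofColumns Y)) with ha
  set d := hMh.eigenvalues with hd
  have hch : ∏ s : Fin N ⊕ Fin (m + 1), (X - C ((Sum.elim a (fun _ => 0) s : ℝ) : ℂ)) =
      ∏ i, (X - C (d i : ℂ)) := by
    have h1 := charpoly_outerWishart (by omega : N ≤ n) hb Y
    rw [charpoly_eq_prod_sortedEigenvalues (wishart_isHermitian b _), ← hM, hMh.charpoly_eq,
      show n - N = m + 1 by omega] at h1
    rw [Fintype.prod_sum_type]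
    simp only [Sum.elim_inl, Sum.elim_inr, Complex.ofReal_zero, map_zero, sub_zero, prod_const,
      card_univ, Fintype.card_fin]
    rw [mul_comm]
    exact h1.symm
  obtain ⟨e, he⟩ := exists_equiv_of_map_univ_eq (map_univ_eq_of_prod_X_sub_C_eq hch)
  have he' : ∀ s, d (e s) = Sum.elim a (fun _ => 0) s := fun s => by exact_mod_cast he s
  set U : Matrix (Fin n) (Fin n) ℂ := (hMh.eigenvectorUnitary : Matrix (Fin n) (Fin n) ℂ) with hU
  have hU1 : U.conjTranspose * U = 1 := Matrix.mem_unitaryGroup_iff'.1 hMh.eigenvectorUnitary.2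
  have hU2 : U * U.conjTranspose = 1 := Matrix.mem_unitaryGroup_iff.1 hMh.eigenvectorUnitary.2
  have hsp : M = U * Matrix.diagonal (fun i => (d i : ℂ)) * U.conjTranspose := by
    conv_lhs => rw [hMh.spectral_theorem, Unitary.conjStarAlgAut_apply]
    rfl
  refine ⟨U, e, hU1, fun w α q hα hq => ?_⟩
  have hev : ∀ i, ∀ᶠ z : ℝ in Filter.atTop, d i < z := fun i => Filter.eventually_gt_atTop _
  filter_upwards [Filter.eventually_all.2 hev, Filter.eventually_gt_atTop 0] with z hz hz0
  have hz' : ∀ i, z ≠ d i := fun i => (hz i).ne'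
  have hW := charpoly_outerWishart (by omega : N + 1 ≤ n) hb
    (Fin.snoc Y (U.mulVec w) : Fin (N + 1) → Fin n → ℂ)
  have hdet := congrArg (eval (z : ℂ)) hW
  rw [outerWishart_snoc hN, ← hM, Matrix.eval_charpoly, eval_mul, eval_pow, eval_X,
    show n - (N + 1) = m by omega] at hdet
  have hconj : Matrix.scalar (Fin n) (z : ℂ) -
      (M + Matrix.vecMulVec (U.mulVec w) (star (U.mulVec w))) =
      U * (Matrix.scalar (Fin n) (z : ℂ) - Matrix.diagonal (fun i => (d i : ℂ)) -
        Matrix.vecMulVec w (star w)) * U.conjTranspose := by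
    have h1 : Matrix.vecMulVec (U.mulVec w) (star (U.mulVec w)) =
        U * Matrix.vecMulVec w (star w) * U.conjTranspose := by
      rw [Matrix.mul_vecMulVec, Matrix.vecMulVec_mul, Matrix.star_mulVec]
    have h2 : Matrix.scalar (Fin n) (z : ℂ) =
        U * Matrix.scalar (Fin n) (z : ℂ) * U.conjTranspose := by
      have hs : Matrix.scalar (Fin n) (z : ℂ) = (z : ℂ) • (1 : Matrix (Fin n) (Fin n) ℂ) := by
        rw [Matrix.scalar_apply, Matrix.smul_one_eq_diagonal]
      rw [hs, Matrix.mul_smul, Matrix.mul_one, Matrix.smul_mul, hU2]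
    rw [h1, hsp]
    conv_lhs => rw [h2]
    rw [Matrix.mul_sub, Matrix.mul_sub, Matrix.sub_mul, Matrix.sub_mul]
    abel
  have hUd : U.det * U.conjTranspose.det = 1 := by rw [← Matrix.det_mul, hU2, Matrix.det_one]
  rw [hconj, Matrix.det_mul, Matrix.det_mul, mul_right_comm, hUd, one_mul,
    det_sub_diagonal_sub_vecMulVec d w hz', ← Equiv.prod_comp e, ← Equiv.sum_comp e,
    Fintype.prod_sum_type, Fintype.sum_sum_type] at hdet
  simp only [he', Sum.elim_inl, Sum.elim_inr, sub_zero, prod_const, card_univ, Fintype.card_fin,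
    ← sum_div] at hdet
  have hza : ∀ i, z - a i ≠ 0 := fun i => by
    have := hz (e (Sum.inl i))
    rw [he'] at this
    exact (sub_pos.2 this).ne'
  -- Of the `m + 1` zeros one stays as the pole `0`; the other `m` match the factor `z ^ m` between
  -- the outer and the inner characteristic polynomial.
  have hzm : (z : ℂ) ^ m ≠ 0 := pow_ne_zero _ (by exact_mod_cast hz0.ne')
  refine mul_left_cancel₀ hzm (hdet.symm.trans ?_)
  rw [← Complex.ofReal_pow, ← Complex.ofReal_mul]
  congr 1
  have hg : ∀ i, z - α i ≠ 0 := fun i => by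
    rw [hα]
    refine Fin.cases ?_ (fun i => ?_) i
    · simpa using hz0.ne'
    · simpa using hza i
  rw [sum_mul_prod_erase_eq q _ hg, hα, hq, Fin.prod_univ_succ (n := N),
    Fin.sum_univ_succ (n := N)]
  simp only [Fin.cons_zero, Fin.cons_succ, sub_zero]
  ring

/-! ### Transition law of the eigenvalues when a column is appended -/

theorem pi_halfLine (n : ℕ) : (Measure.pi fun _ : Fin n => halfLine) =
    volume.restrict (Set.univ.pi fun _ => Set.Ioi 0) := by
  rw [volume_pi, Measure.restrict_pi_pi]
  rfl

theorem lintegral_pi_sum {n N k : ℕ} (e : Fin N ⊕ Fin k ≃ Fin n) {G : (Fin n → ℝ) → ENNReal}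
    (hG : Measurable G) :
    ∫⁻ t, G t ∂(Measure.pi fun _ => halfLine) =
      ∫⁻ s, ∫⁻ u, G (fun i => Sum.elim s u (e.symm i)) ∂(Measure.pi fun _ => halfLine)
        ∂(Measure.pi fun _ => halfLine) := by
  have h1 := measurePreserving_piCongrLeft (α := fun _ : Fin n => ℝ) (fun _ => halfLine) e
  have h2 := measurePreserving_sumPiEquivProdPi_symm (X := fun _ : Fin N ⊕ Fin k => ℝ)
    (fun _ => halfLine)
  have h3 := h1.comp h2
  rw [← h3.lintegral_comp hG]
  have hm : Measurable fun p : (Fin N → ℝ) × (Fin k → ℝ) =>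
      G (((MeasurableEquiv.piCongrLeft (fun _ => ℝ) e) ∘
        (MeasurableEquiv.sumPiEquivProdPi fun _ => ℝ).symm) p) := hG.comp h3.measurable
  refine (lintegral_prod _ hm.aemeasurable).trans ?_
  refine lintegral_congr fun s => lintegral_congr fun u => ?_
  congr 1
  funext i
  obtain ⟨j, rfl⟩ := e.surjective i
  simp only [Function.comp_apply, MeasurableEquiv.coe_piCongrLeft, Equiv.piCongrLeft_apply_apply,
    Equiv.symm_apply_apply]
  cases j <;> rfl

/-- The transition density of the increasing nonzero eigenvalues under a rank one update. -/
def updateKernel {N : ℕ} (m : ℕ) (a : Fin N → ℝ) (x : Fin (N + 1) → ℝ) : ℝ :=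
  diffProd x / diffProd (Fin.cons 0 a : Fin (N + 1) → ℝ) *
    (((∏ i, x i) / ∏ i, a i) ^ m / (m.factorial : ℝ) * Real.exp (-(∑ i, x i - ∑ i, a i)))

/-- The vectors with `0 < x_0 < x_1 < ⋯`. -/
def chamber (N : ℕ) : Set (Fin N → ℝ) := {x | (∀ i, 0 < x i) ∧ StrictMono x}

theorem strictMono_cons_zero {N : ℕ} {a : Fin N → ℝ} (ha : a ∈ chamber N) :
    StrictMono (Fin.cons 0 a : Fin (N + 1) → ℝ) := by
  intro i j hij
  revert hij
  refine Fin.cases ?_ (fun i => ?_) i <;> refine Fin.cases ?_ (fun j => ?_) j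
  · simp
  · intro _
    simpa using ha.1 j
  · simp
  · intro hij
    simpa using ha.2 (Fin.succ_lt_succ_iff.1 hij)

theorem secularWeights_cons_zero {N : ℕ} (a : Fin N → ℝ) (x : Fin (N + 1) → ℝ) :
    secularWeights (Fin.cons 0 a) x 0 = (∏ i, x i) / ∏ i, a i := by
  rw [secularWeights, nodalWeight_zero]
  simp only [Fin.cons_zero, Fin.cons_succ, zero_sub]
  rw [prod_neg, prod_inv_distrib, prod_neg]
  simp only [card_univ, Fintype.card_fin]
  rw [mul_inv, pow_succ, div_eq_mul_inv, ← inv_pow]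
  have h : ((-1 : ℝ) ^ N) * ((-1)⁻¹) ^ N = 1 := by
    rw [← mul_pow]
    norm_num
  linear_combination (∏ i, x i) * (∏ i, a i)⁻¹ * h

/-- By unitary invariance the new column may be taken in the eigenbasis. The secular weights are
then independent, Gamma at the pole `0` and exponential at the others, with density `q_0^m / m! ·
exp (-∑ q)`. Changing variables from `q` to `x` supplies the Vandermonde quotient, `q_0 = ∏ x / ∏ a`
and `∑ q = ∑ x - ∑ a`. -/
theorem lintegral_update {n N m : ℕ} (hn : n = N + m + 1) (hN : 1 ≤ N) {b : ℝ} (hb : 0 < b)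
    (Y : Fin N → Fin n → ℂ) {a : Fin N → ℝ}
    (hYa : sortedEigenvalues (wishart b (ofColumns Y)) = a) (ha : a ∈ chamber N)
    {f : (Fin (N + 1) → ℝ) → ENNReal} (hf : Measurable f) :
    ∫⁻ v, f (sortedEigenvalues (wishart b (ofColumns (Fin.snoc Y v : Fin (N + 1) → Fin n → ℂ))))
        ∂gaussianVector n =
      ∫⁻ x in interlacing (Fin.cons 0 a), f x * ENNReal.ofReal (updateKernel m a x) := by
  obtain ⟨U, e, hU, hch⟩ := exists_unitary_charpoly_update hn hN hb Y
  rw [hYa] at hch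
  set α : Fin (N + 1) → ℝ := Fin.cons 0 a with hα
  have hαm : StrictMono α := strictMono_cons_zero ha
  set g : (Fin n → ℂ) → ENNReal := fun w => f (sortedEigenvalues (wishart b (ofColumns
    (Fin.snoc Y (U.mulVec w) : Fin (N + 1) → Fin n → ℂ)))) with hg
  have hUc : Continuous fun w : Fin n → ℂ => U.mulVec w :=
    Continuous.matrix_mulVec continuous_const continuous_id
  have hsnoc : Continuous fun v : Fin n → ℂ => (Fin.snoc Y v : Fin (N + 1) → Fin n → ℂ) :=
    continuous_const.finSnoc continuous_id
  have hgc : ∀ w w' : Fin n → ℂ, (∑ j, ‖w (e (Sum.inr j))‖ ^ 2 = ∑ j, ‖w' (e (Sum.inr j))‖ ^ 2) →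
      (∀ j, ‖w (e (Sum.inl j))‖ ^ 2 = ‖w' (e (Sum.inl j))‖ ^ 2) → g w = g w' := by
    intro w w' h1 h2
    refine congrArg f (sortedEigenvalues_congr (eq_of_eventually_eval_ofReal_eq ?_))
    filter_upwards [hch w α _ rfl rfl, hch w' α _ rfl rfl] with z hz hz'
    rw [hz, hz', h1]
    simp_rw [h2]
  -- A continuous choice of vector with prescribed weights, the mass at the pole `0` being put in
  -- one coordinate. It exhibits `g` as a measurable function `H` of the weights.
  set pt : (Fin (N + 1) → ℝ) → Fin n → ℂ := fun q i =>
    Sum.elim (fun j : Fin N => ((√(q j.succ) : ℝ) : ℂ))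
      (fun j : Fin (m + 1) => if j = 0 then ((√(q 0) : ℝ) : ℂ) else 0) (e.symm i) with hpt
  have hptc : Continuous pt := by
    refine continuous_pi fun i => ?_
    rcases hi : e.symm i with j | j
    · simp only [hpt, hi, Sum.elim_inl]
      fun_prop
    · simp only [hpt, hi, Sum.elim_inr]
      split_ifs <;> fun_prop
  set H : (Fin (N + 1) → ℝ) → ENNReal := fun q => g (pt q) with hH
  have hHm : Measurable H :=
    hf.comp (measurable_sortedEigenvalues
      (continuous_wishart_ofColumns b (hsnoc.comp (hUc.comp hptc))))
  have hpt1 : ∀ q : Fin (N + 1) → ℝ, 0 ≤ q 0 →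
      ∑ j, ‖pt q (e (Sum.inr j))‖ ^ 2 = q 0 := by
    intro q hq
    rw [sum_eq_single 0]
    · simp [hpt, Real.sq_sqrt hq]
    · intro j _ hj
      simp [hpt, hj]
    · simp
  have hpt2 : ∀ q : Fin (N + 1) → ℝ, ∀ j : Fin N, 0 ≤ q j.succ →
      ‖pt q (e (Sum.inl j))‖ ^ 2 = q j.succ := by
    intro q j hq
    simp [hpt, Real.sq_sqrt hq]
  have hgH : ∀ w : Fin n → ℂ, g w =
      H (Fin.cons (∑ j, ‖w (e (Sum.inr j))‖ ^ 2) fun j => ‖w (e (Sum.inl j))‖ ^ 2) := by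
    intro w
    refine hgc _ _ ?_ fun j => ?_
    · rw [hpt1 _ (by simp only [Fin.cons_zero]; positivity), Fin.cons_zero]
    · rw [hpt2 _ _ (by simp only [Fin.cons_succ]; positivity), Fin.cons_succ]
  have hHval : ∀ x ∈ interlacing α, H (secularWeights α x) = f x := by
    intro x hx
    have hpos := fun j => (secularWeights_pos hαm hx j).le
    refine congrArg f (sortedEigenvalues_eq (strictMono_of_mem_interlacing hx).monotone
      (eq_of_eventually_eval_ofReal_eq ?_))
    have hq : secularWeights α x = Fin.cons (∑ j, ‖pt (secularWeights α x) (e (Sum.inr j))‖ ^ 2)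
        (fun j => ‖pt (secularWeights α x) (e (Sum.inl j))‖ ^ 2) := by
      funext j
      refine Fin.cases ?_ (fun j => ?_) j
      · rw [Fin.cons_zero, hpt1 _ (hpos 0)]
      · rw [Fin.cons_succ, hpt2 _ _ (hpos _)]
    filter_upwards [hch (pt (secularWeights α x)) α _ rfl hq] with z hz
    rw [hz, ← prod_sub_eq_of_secularWeights hαm.injective, eval_prod]
    simp
  have hcons : ∀ (s : Fin N → ℝ), Measurable fun r : ℝ => H (Fin.cons r s) := fun s =>
    hHm.comp (measurable_pi_lambda _ fun j => by
      refine Fin.cases ?_ (fun j => ?_) j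
      · simp only [Fin.cons_zero]
        exact measurable_id
      · simp only [Fin.cons_succ]
        exact measurable_const)
  have hmerge : Measurable fun t : Fin n → ℝ =>
      H (Fin.cons (∑ j, t (e (Sum.inr j))) fun j => t (e (Sum.inl j))) :=
    hHm.comp (measurable_pi_lambda _ fun j => by
      refine Fin.cases ?_ (fun j => ?_) j
      · simp only [Fin.cons_zero]
        fun_prop
      · simp only [Fin.cons_succ]
        fun_prop)
  have hfm : Measurable fun v : Fin n → ℂ => f (sortedEigenvalues (wishart b (ofColumns
      (Fin.snoc Y v : Fin (N + 1) → Fin n → ℂ)))) :=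
    hf.comp (measurable_sortedEigenvalues (continuous_wishart_ofColumns b hsnoc))
  calc _ = ∫⁻ w, g w ∂gaussianVector n := by
        conv_lhs => rw [← map_mulVec_gaussianVector hU]
        exact lintegral_map hfm hUc.measurable
    _ = ∫⁻ t, H (Fin.cons (∑ j, t (e (Sum.inr j))) fun j => t (e (Sum.inl j))) *
          ∏ i, ENNReal.ofReal (Real.exp (-t i)) ∂(Measure.pi fun _ => halfLine) := by
        simp_rw [hgH]
        exact lintegral_gaussianVector_sq_norm hmerge
    _ = ∫⁻ s : Fin N → ℝ, (∫⁻ u : Fin (m + 1) → ℝ, (H (Fin.cons (∑ j, u j) s) *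
          ∏ i, ENNReal.ofReal (Real.exp (-s i))) * ∏ i, ENNReal.ofReal (Real.exp (-u i))
            ∂(Measure.pi fun _ => halfLine)) ∂(Measure.pi fun _ => halfLine) := by
        rw [lintegral_pi_sum e (by fun_prop)]
        refine lintegral_congr fun s => lintegral_congr fun u => ?_
        rw [← Equiv.prod_comp e, Fintype.prod_sum_type]
        simp only [Equiv.symm_apply_apply, Sum.elim_inl, Sum.elim_inr]
        rw [mul_assoc]
    _ = ∫⁻ s : Fin N → ℝ, (∫⁻ r, (H (Fin.cons r s) *
          ∏ i, ENNReal.ofReal (Real.exp (-s i))) *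
            ENNReal.ofReal (r ^ m / (m.factorial : ℝ) * Real.exp (-r)) ∂halfLine)
              ∂(Measure.pi fun _ => halfLine) := by
        refine lintegral_congr fun s => ?_
        -- The `m + 1` exponential variables along the zeros enter only through their sum.
        have := hcons s
        exact hasSumDensity_exp_neg m (fun r => H (Fin.cons r s) *
          ∏ i, ENNReal.ofReal (Real.exp (-s i))) (by fun_prop)
    _ = ∫⁻ q : Fin (N + 1) → ℝ, H q * ENNReal.ofReal
          (q 0 ^ m / (m.factorial : ℝ) * Real.exp (-∑ i, q i))
            ∂(Measure.pi fun _ => halfLine) := by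
        have hc2 : Measurable fun p : (Fin N → ℝ) × ℝ => H (Fin.cons p.2 p.1) :=
          hHm.comp (measurable_pi_lambda _ fun j => by
            refine Fin.cases ?_ (fun j => ?_) j
            · simpa using measurable_snd
            · simp only [Fin.cons_succ]
              fun_prop)
        rw [lintegral_pi_insertNth _ 0 (by fun_prop), lintegral_lintegral_swap (by fun_prop)]
        refine lintegral_congr fun r => lintegral_congr fun s => ?_
        rw [Fin.insertNth_zero', Fin.sum_univ_succ, mul_assoc]
        simp only [Fin.cons_zero, Fin.cons_succ]
        congr 1
        rw [← ENNReal.ofReal_prod_of_nonneg fun i _ => (Real.exp_pos _).le, ← Real.exp_sum,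
          ← ENNReal.ofReal_mul (Real.exp_pos _).le, neg_add, Real.exp_add, sum_neg_distrib]
        congr 1
        ring
    _ = _ := by
        rw [pi_halfLine, lintegral_Ioi_eq_lintegral_interlacing hαm]
        refine setLIntegral_congr_fun (measurableSet_interlacing α) fun x hx => ?_
        have h0 : 0 ≤ diffProd x / diffProd α :=
          div_nonneg (diffProd_pos (strictMono_of_mem_interlacing hx)).le (diffProd_pos hαm).le
        have hsum : ∑ i, α i = ∑ i, a i := by simp [hα, Fin.sum_univ_succ]
        rw [hHval x hx, mul_left_comm, ← ENNReal.ofReal_mul h0,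
          sum_secularWeights hαm.injective, hsum, hα, secularWeights_cons_zero, updateKernel]

end

section

open Finset

/-! ### Integrating the bordered Vandermonde determinant over a box -/

/-- The points `a` with `x_0 < a_0 < x_1 < a_1 < ⋯ < x_N`. -/
def gapBox {N : ℕ} (x : Fin (N + 1) → ℝ) : Set (Fin N → ℝ) :=
  Set.univ.pi fun i => Set.Ioo (x i.castSucc) (x i.succ)

/-- The constant relating integrals of bordered Vandermonde determinants of consecutive sizes. -/
def borderedCoeff (N : ℕ) (c : ℝ) : ℝ :=
  ∏ k : Fin N, if (k : ℕ) + 1 = N then c⁻¹ else ((k : ℕ) + 1 : ℝ)⁻¹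

theorem borderedCoeff_ne_zero (N : ℕ) {c : ℝ} (hc : c ≠ 0) : borderedCoeff N c ≠ 0 := by
  refine prod_ne_zero_iff.2 fun k _ => ?_
  split_ifs
  · exact inv_ne_zero hc
  · positivity

/-- As `N ≥ 1`, column `0` consists of ones and is not the exponential column. Subtracting from each
row its predecessor and expanding along that column leaves differences between consecutive points.
-/
theorem det_borderedVandermonde_succ {N : ℕ} (hN : 1 ≤ N) (c : ℝ) (x : Fin (N + 1) → ℝ) :
    (borderedVandermonde c x).det = (Matrix.of fun j k : Fin N =>
      borderedVandermonde c x j.succ k.succ - borderedVandermonde c x j.castSucc k.succ).det := by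
  set B := borderedVandermonde c x with hB
  set B' : Matrix (Fin (N + 1)) (Fin (N + 1)) ℝ := Matrix.of fun j k =>
    (Fin.cons (B 0 k) (fun i : Fin N => B i.succ k - B i.castSucc k) : Fin (N + 1) → ℝ) j with hB'
  have h0 : ∀ j, B j 0 = 1 := fun j => by
    have : ¬(0 = N) := by omega
    simp [hB, borderedVandermonde, this]
  have h1 : B.det = B'.det := by
    refine Matrix.det_eq_of_forall_row_eq_smul_add_pred (fun _ => 1) (fun k => ?_) fun i k => ?_
    · simp [hB']
    · simp [hB']
  rw [h1, Matrix.det_succ_column_zero, Fin.sum_univ_succ]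
  have h2 : ∀ i : Fin N, B' i.succ 0 = 0 := fun i => by simp [hB', h0]
  have h3 : B' 0 0 = 1 := by simp [hB', h0]
  simp only [h2, h3, mul_zero, zero_mul, sum_const_zero, add_zero, Fin.val_zero, pow_zero, one_mul]
  congr 1

theorem integral_Ioo_pow {p q : ℝ} (h : p ≤ q) (k : ℕ) :
    ∫ t in Set.Ioo p q, t ^ k = ((k : ℝ) + 1)⁻¹ * (q ^ (k + 1) - p ^ (k + 1)) := by
  rw [← integral_Ioc_eq_integral_Ioo, ← intervalIntegral.integral_of_le h, integral_pow]
  ring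

theorem integral_Ioo_exp {p q c : ℝ} (h : p ≤ q) (hc : c ≠ 0) :
    ∫ t in Set.Ioo p q, Real.exp (c * t) = c⁻¹ * (Real.exp (c * q) - Real.exp (c * p)) := by
  rw [← integral_Ioc_eq_integral_Ioo, ← intervalIntegral.integral_of_le h,
    intervalIntegral.integral_comp_mul_left (fun s => Real.exp s) hc, integral_exp, smul_eq_mul]

theorem continuous_det_borderedVandermonde {N : ℕ} (c : ℝ) :
    Continuous fun a : Fin N → ℝ => (borderedVandermonde c a).det := by
  refine Continuous.matrix_det (continuous_matrix fun j k => ?_)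
  simp only [borderedVandermonde, Matrix.of_apply]
  split_ifs <;> fun_prop

theorem integrableOn_gapBox {N : ℕ} (x : Fin (N + 1) → ℝ) {g : (Fin N → ℝ) → ℝ}
    (hg : Continuous g) : IntegrableOn g (gapBox x) := by
  have hK : IsCompact (Set.univ.pi fun i : Fin N => Set.Icc (x i.castSucc) (x i.succ)) :=
    isCompact_univ_pi fun _ => isCompact_Icc
  exact (hg.continuousOn.integrableOn_compact hK).mono_set
    (Set.pi_mono fun i _ => Set.Ioo_subset_Icc_self)

/-- Row `j` depends on `a j` alone, so the integral passes to the entries of the Leibniz expansion.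
The integral of column `k` over a gap is a constant times the difference, across that gap, of column
`k + 1` of the larger matrix. -/
theorem integral_gapBox_det {N : ℕ} (hN : 1 ≤ N) {c : ℝ} (hc : c ≠ 0) {x : Fin (N + 1) → ℝ}
    (hx : StrictMono x) :
    ∫ a in gapBox x, (borderedVandermonde c a).det =
      borderedCoeff N c * (borderedVandermonde c x).det := by
  set g : Fin N → ℝ → ℝ := fun k t => if (k : ℕ) + 1 = N then Real.exp (c * t) else t ^ (k : ℕ)
    with hg
  have hgc : ∀ k, Continuous (g k) := fun k => by
    simp only [hg]
    split_ifs <;> fun_prop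
  have hdet : ∀ a : Fin N → ℝ, (borderedVandermonde c a).det =
      ∑ σ : Equiv.Perm (Fin N), ((Equiv.Perm.sign σ : ℤ) : ℝ) * ∏ i, g (σ i) (a i) := fun a => by
    rw [← Matrix.det_transpose, Matrix.det_apply']
    rfl
  have hint : ∀ j k : Fin N, ∫ t in Set.Ioo (x j.castSucc) (x j.succ), g k t =
      (if (k : ℕ) + 1 = N then c⁻¹ else ((k : ℕ) + 1 : ℝ)⁻¹) *
        (borderedVandermonde c x j.succ k.succ - borderedVandermonde c x j.castSucc k.succ) := by
    intro j k
    have hle : x j.castSucc ≤ x j.succ := (hx Fin.castSucc_lt_succ).le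
    by_cases hk : (k : ℕ) + 1 = N
    · simp only [hg, hk, if_true, borderedVandermonde, Matrix.of_apply, Fin.val_succ]
      exact integral_Ioo_exp hle hc
    · simp only [hg, hk, if_false, borderedVandermonde, Matrix.of_apply, Fin.val_succ,
        Nat.add_right_cancel_iff]
      exact integral_Ioo_pow hle k
  simp_rw [hdet]
  rw [integral_finsetSum]
  · simp_rw [integral_const_mul]
    have hprod : ∀ σ : Equiv.Perm (Fin N), ∫ a in gapBox x, ∏ i, g (σ i) (a i) =
        ∏ i, ∫ t in Set.Ioo (x i.castSucc) (x i.succ), g (σ i) t := fun σ => by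
      rw [gapBox, volume_pi, Measure.restrict_pi_pi]
      exact integral_fintype_prod_eq_prod (fun i => g (σ i))
    simp_rw [hprod, hint]
    rw [det_borderedVandermonde_succ hN, borderedCoeff, ← Matrix.det_mul_row,
      ← Matrix.det_transpose, Matrix.det_apply']
    rfl
  · intro σ _
    refine integrableOn_gapBox x ?_
    have := fun i => hgc (σ i)
    fun_prop

/-! ### The law of the increasing eigenvalues -/

theorem measurableSet_chamber (N : ℕ) : MeasurableSet (chamber N) := by
  have h : chamber N = {x | ∀ i, 0 < x i} ∩ {x | ∀ i j, i < j → x i < x j} := rfl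
  rw [h]
  simp only [Set.ofPred_forall]
  refine MeasurableSet.inter ?_ ?_
  · exact MeasurableSet.iInter fun i => measurableSet_lt measurable_const (measurable_pi_apply i)
  · exact MeasurableSet.iInter fun i => MeasurableSet.iInter fun j => MeasurableSet.iInter fun _ =>
      measurableSet_lt (measurable_pi_apply i) (measurable_pi_apply j)

/-- One region seen from either side, as needed to integrate over `a` first instead of `x`. -/
theorem mem_chamber_and_mem_interlacing_iff {N : ℕ} {a : Fin N → ℝ} {x : Fin (N + 1) → ℝ} :
    a ∈ chamber N ∧ x ∈ interlacing (Fin.cons 0 a) ↔ x ∈ chamber (N + 1) ∧ a ∈ gapBox x := by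
  constructor
  · rintro ⟨ha, hx⟩
    have hm := strictMono_of_mem_interlacing hx
    have h0 : 0 < x 0 := by simpa using (hx 0).1
    refine ⟨⟨fun i => h0.trans_le (hm.monotone (Fin.zero_le i)), hm⟩, fun i _ => ⟨?_, ?_⟩⟩
    · simpa using (hx i.castSucc).2 i.succ Fin.castSucc_lt_succ
    · simpa using (hx i.succ).1
  · rintro ⟨hx, ha⟩
    have ha1 : ∀ i, x i.castSucc < a i := fun i => (ha i trivial).1
    have ha2 : ∀ i, a i < x i.succ := fun i => (ha i trivial).2
    refine ⟨⟨fun i => (hx.1 _).trans (ha1 i), fun i j hij => ?_⟩, fun j => ⟨?_, fun i hi => ?_⟩⟩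
    · exact (ha2 i).trans ((hx.2.monotone (Fin.succ_le_castSucc_iff.2 hij)).trans_lt (ha1 j))
    · refine Fin.cases ?_ (fun j => ?_) j
      · simpa using hx.1 0
      · simpa using ha2 j
    · revert hi
      refine Fin.cases ?_ (fun i => ?_) i
      · intro hi
        exact absurd hi (Fin.not_lt_zero j)
      · intro hi
        rw [Fin.cons_succ]
        exact (hx.2.monotone (Fin.le_castSucc_iff.2 hi)).trans_lt (ha1 i)

theorem diffProd_cons_zero {N : ℕ} (a : Fin N → ℝ) :
    diffProd (Fin.cons 0 a : Fin (N + 1) → ℝ) = (∏ i, a i) * diffProd a := by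
  simp only [diffProd, Fin.prod_univ_succ, Fin.prod_Ioi_zero, Fin.prod_Ioi_succ, Fin.cons_zero,
    Fin.cons_succ, sub_zero]

/-- The eigenvalue weight `∏ x_l ^ m e^{-x_l} ∏_{j < k} (x_k - x_j)`. -/
def laguerreWeight {N : ℕ} (m : ℕ) (x : Fin N → ℝ) : ℝ :=
  (∏ l, x l ^ m * Real.exp (-x l)) * diffProd x

theorem laguerreWeight_pos {N : ℕ} (m : ℕ) {x : Fin N → ℝ} (hx : x ∈ chamber N) :
    0 < laguerreWeight m x :=
  mul_pos (prod_pos fun l _ => mul_pos (pow_pos (hx.1 l) _) (Real.exp_pos _)) (diffProd_pos hx.2)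

theorem detForm_eq (n N : ℕ) (b : ℝ) (x : Fin N → ℝ) :
    detForm n N b x = laguerreWeight (n - N) x * (borderedVandermonde (1 - 1 / b) x).det := rfl

/-- The decisive cancellation: `Δ(0, a) = ∏ a · Δ(a)` together with `(∏ a)^m` uses up the power `m +
1`, and the exponentials of `a` cancel. -/
theorem updateKernel_mul_laguerreWeight {N : ℕ} (m : ℕ) {a : Fin N → ℝ} (ha : a ∈ chamber N)
    (x : Fin (N + 1) → ℝ) :
    updateKernel m a x * laguerreWeight (m + 1) a = laguerreWeight m x / (m.factorial : ℝ) := by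
  have h1 : ∏ i, a i ≠ 0 := prod_ne_zero_iff.2 fun i _ => (ha.1 i).ne'
  have h2 := (diffProd_pos ha.2).ne'
  have h3 : ((m.factorial : ℕ) : ℝ) ≠ 0 := by exact_mod_cast (Nat.factorial_pos m).ne'
  rw [updateKernel, laguerreWeight, laguerreWeight, diffProd_cons_zero, prod_mul_distrib,
    prod_mul_distrib, prod_pow, prod_pow, ← Real.exp_sum, ← Real.exp_sum, neg_sub, Real.exp_sub,
    sum_neg_distrib, sum_neg_distrib, Real.exp_neg, Real.exp_neg, div_pow]
  field_simp
  ring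

theorem measurable_diffProd {N : ℕ} : Measurable (diffProd (N := N)) := by
  unfold diffProd
  fun_prop

theorem measurable_detForm (n N : ℕ) (b : ℝ) : Measurable (detForm n N b) := by
  have h1 := measurable_diffProd (N := N)
  have h2 := (continuous_det_borderedVandermonde (N := N) (1 - 1 / b)).measurable
  unfold detForm
  fun_prop

theorem measurable_updateKernel {N : ℕ} (m : ℕ) :
    Measurable fun p : (Fin N → ℝ) × (Fin (N + 1) → ℝ) => updateKernel m p.1 p.2 := by
  have h1 := measurable_diffProd (N := N)
  have h2 := measurable_diffProd (N := N + 1)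
  simp only [updateKernel, diffProd_cons_zero]
  fun_prop

/-! ### Base case: a single column -/

theorem lintegral_halfLine_comp_mul {b : ℝ} (hb : 0 < b) (g : ℝ → ENNReal) :
    ∫⁻ t, g t ∂halfLine = ∫⁻ r, ENNReal.ofReal b * g (b * r) ∂halfLine := by
  have himg : (fun r => b * r) '' Set.Ioi 0 = Set.Ioi 0 := by
    rw [Set.image_mul_left_Ioi hb, mul_zero]
  rw [halfLine]
  conv_lhs => rw [← himg]
  rw [lintegral_image_eq_lintegral_abs_deriv_mul measurableSet_Ioi
    (fun r _ => (hasDerivAt_const_mul b).hasDerivWithinAt)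
    (mul_right_injective₀ hb.ne').injOn]
  simp [abs_of_pos hb]

theorem sortedEigenvalues_wishart_one {n : ℕ} {b : ℝ} (hb : 0 < b) (v : Fin n → ℂ) :
    sortedEigenvalues (wishart b (ofColumns fun _ : Fin 1 => v)) =
      fun _ => b * ∑ i, ‖v i‖ ^ 2 := by
  refine sortedEigenvalues_eq (fun i j _ => le_rfl) ?_
  rw [Matrix.charpoly, Matrix.det_fin_one, Matrix.charmatrix_apply_eq, Fin.prod_univ_one]
  congr 2
  have hs : ((√b : ℝ) : ℂ) * ((√b : ℝ) : ℂ) = b := by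
    rw [← Complex.ofReal_mul, Real.mul_self_sqrt hb.le]
  rw [wishart, spikeSqrt, Matrix.mul_diagonal, Matrix.mul_assoc, Matrix.diagonal_mul,
    Matrix.mul_apply]
  push_cast
  rw [← hs, mul_sum, mul_sum, sum_mul]
  refine sum_congr rfl fun i _ => ?_
  rw [← Complex.conj_mul']
  simp [ofColumns]
  ring

/-- The eigenvalue is `b ‖v‖²`, a Gamma variable of scale `b`, and `e^(-x) e^(c x) = e^(-x / b)`.
The case `b = 1` is included. -/
theorem lintegral_sortedEigenvalues_one {n : ℕ} (hn : 1 ≤ n) {b : ℝ} (hb : 0 < b) :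
    ∃ K : ℝ, K ≠ 0 ∧ (∀ x ∈ chamber 1, 0 ≤ K * detForm n 1 b x) ∧
      ∀ f : (Fin 1 → ℝ) → ENNReal, Measurable f →
        ∫⁻ Y, f (sortedEigenvalues (wishart b (ofColumns Y)))
          ∂(Measure.pi fun _ : Fin 1 => gaussianVector n) =
        ∫⁻ x in chamber 1, f x * ENNReal.ofReal (K * detForm n 1 b x) := by
  obtain ⟨m, rfl⟩ : ∃ m, n = m + 1 := ⟨n - 1, by omega⟩
  have hform : ∀ x : Fin 1 → ℝ, detForm (m + 1) 1 b x = x 0 ^ m * Real.exp (-(x 0 / b)) := by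
    intro x
    simp only [detForm, diffProd, borderedVandermonde, Matrix.det_fin_one, Matrix.of_apply,
      Fin.prod_univ_one, Nat.add_sub_cancel]
    rw [show -(x 0 / b) = -x 0 + (1 - 1 / b) * x 0 by ring, Real.exp_add]
    simp
    ring
  have hfac := Nat.factorial_pos m
  refine ⟨(b ^ (m + 1) * (m.factorial : ℝ))⁻¹, by positivity, fun x hx => ?_, fun f hf => ?_⟩
  · have := hx.1 0
    rw [hform]
    positivity
  · have hch : chamber 1 = Set.univ.pi fun _ => Set.Ioi 0 := by
      ext x
      simp only [chamber, Set.mem_ofPred_eq, Set.mem_pi, Set.mem_univ, true_implies, Set.mem_Ioi]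
      exact ⟨fun h => h.1, fun h => ⟨h, Subsingleton.strictMono x⟩⟩
    have hc : Continuous fun Y : Fin 1 → Fin (m + 1) → ℂ => wishart b (ofColumns Y) :=
      continuous_wishart_ofColumns b continuous_id
    have hf0 : Measurable fun r : ℝ => f fun _ => r := by fun_prop
    have hsum := hasSumDensity_exp_neg m (fun r => f fun _ => b * r) (by fun_prop)
    have hcst : ∀ (a : ℝ) (y : Fin 0 → ℝ), (Fin.insertNth 0 a y : Fin 1 → ℝ) = fun _ => a := by
      intro a y
      funext i
      rw [Fin.eq_zero i, Fin.insertNth_apply_same]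
    have hcst' : ∀ (a : Fin (m + 1) → ℂ) (y : Fin 0 → Fin (m + 1) → ℂ),
        (Fin.insertNth 0 a y : Fin 1 → Fin (m + 1) → ℂ) = fun _ => a := by
      intro a y
      funext i
      rw [Fin.eq_zero i, Fin.insertNth_apply_same]
    have hdm := measurable_detForm (m + 1) 1 b
    rw [hch, ← pi_halfLine, lintegral_pi_insertNth (F := fun x : Fin 1 → ℝ => f x *
        ENNReal.ofReal ((b ^ (m + 1) * (m.factorial : ℝ))⁻¹ * detForm (m + 1) 1 b x)) _ 0
        (by fun_prop),
      lintegral_pi_insertNth (F := fun Y : Fin 1 → Fin (m + 1) → ℂ =>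
        f (sortedEigenvalues (wishart b (ofColumns Y)))) _ 0
        (hf.comp (measurable_sortedEigenvalues hc))]
    simp_rw [hcst, hcst', sortedEigenvalues_wishart_one hb]
    simp only [lintegral_const, Measure.pi_univ, univ_eq_empty, prod_empty, mul_one]
    have h1 := lintegral_gaussianVector_sq_norm (n := m + 1)
      (H := fun t => f fun _ => b * ∑ i, t i) (by fun_prop)
    rw [h1, hsum]
    refine Eq.trans ?_ (lintegral_halfLine_comp_mul hb _).symm
    refine setLIntegral_congr_fun measurableSet_Ioi fun r hr => ?_
    have hr0 : 0 < r := hr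
    simp only
    rw [mul_left_comm, ← ENNReal.ofReal_mul hb.le, hform]
    congr 2
    field_simp
    ring

end

/-! ### Induction on the number of columns -/

section

open Finset

set_option maxHeartbeats 1000000 in
-- Condition on the first `N` columns, apply the transition density, and exchange the order of
-- integration so that the old eigenvalues are integrated out over the gap box.
theorem lintegral_sortedEigenvalues_succ {n N : ℕ} (hN : 1 ≤ N) (hNn : N + 1 ≤ n) {b : ℝ}
    (hb : 0 < b) (hb1 : b ≠ 1) {K : ℝ} (hK : K ≠ 0)
    (hK0 : ∀ x ∈ chamber N, 0 ≤ K * detForm n N b x)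
    (ih : ∀ f : (Fin N → ℝ) → ENNReal, Measurable f →
      ∫⁻ Y, f (sortedEigenvalues (wishart b (ofColumns Y)))
        ∂(Measure.pi fun _ : Fin N => gaussianVector n) =
      ∫⁻ x in chamber N, f x * ENNReal.ofReal (K * detForm n N b x)) :
    ∃ K' : ℝ, K' ≠ 0 ∧ (∀ x ∈ chamber (N + 1), 0 ≤ K' * detForm n (N + 1) b x) ∧
      ∀ f : (Fin (N + 1) → ℝ) → ENNReal, Measurable f →
        ∫⁻ Y, f (sortedEigenvalues (wishart b (ofColumns Y)))
          ∂(Measure.pi fun _ : Fin (N + 1) => gaussianVector n) =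
        ∫⁻ x in chamber (N + 1), f x * ENNReal.ofReal (K' * detForm n (N + 1) b x) := by
  obtain ⟨m, rfl⟩ : ∃ m, n = N + m + 1 := ⟨n - N - 1, by omega⟩
  set c : ℝ := 1 - 1 / b with hc
  have hc0 : c ≠ 0 := one_sub_one_div_ne_zero hb hb1
  have hfac : (0 : ℝ) < m.factorial := by exact_mod_cast Nat.factorial_pos m
  have hform : ∀ a : Fin N → ℝ, detForm (N + m + 1) N b a =
      laguerreWeight (m + 1) a * (borderedVandermonde c a).det := fun a => by
    rw [detForm_eq, show N + m + 1 - N = m + 1 by omega]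
  have hform' : ∀ x : Fin (N + 1) → ℝ, detForm (N + m + 1) (N + 1) b x =
      laguerreWeight m x * (borderedVandermonde c x).det := fun x => by
    rw [detForm_eq, show N + m + 1 - (N + 1) = m by omega]
  have hB0 : ∀ a ∈ chamber N, 0 ≤ K * (borderedVandermonde c a).det := fun a ha => by
    have h := hK0 a ha
    rw [hform, mul_left_comm] at h
    exact nonneg_of_mul_nonneg_right h (laguerreWeight_pos _ ha)
  have hgap : ∀ x ∈ chamber (N + 1), ∀ a ∈ gapBox x, a ∈ chamber N := fun x hx a ha =>
    (mem_chamber_and_mem_interlacing_iff.2 ⟨hx, ha⟩).1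
  have hgapm : ∀ x : Fin (N + 1) → ℝ, MeasurableSet (gapBox x) := fun x =>
    MeasurableSet.univ_pi fun _ => measurableSet_Ioo
  -- `borderedCoeff` comes from the gap box integral and `m!` from the Gamma density of the weight
  -- at `0`.
  set K' : ℝ := K * borderedCoeff N c / m.factorial with hK'
  have hval : ∀ x ∈ chamber (N + 1), K' * detForm (N + m + 1) (N + 1) b x =
      laguerreWeight m x / m.factorial * ∫ a in gapBox x, K * (borderedVandermonde c a).det := by
    intro x hx
    rw [integral_const_mul, integral_gapBox_det hN hc0 hx.2, hform', hK']
    ring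
  have hI0 : ∀ x ∈ chamber (N + 1), 0 ≤ ∫ a in gapBox x, K * (borderedVandermonde c a).det :=
    fun x hx => setIntegral_nonneg (hgapm x) fun a ha => hB0 a (hgap x hx a ha)
  refine ⟨K', div_ne_zero (mul_ne_zero hK (borderedCoeff_ne_zero N hc0)) hfac.ne', ?_, ?_⟩
  · intro x hx
    rw [hval x hx]
    exact mul_nonneg (div_nonneg (laguerreWeight_pos m hx).le hfac.le) (hI0 x hx)
  intro f hf
  set S : Set ((Fin N → ℝ) × (Fin (N + 1) → ℝ)) :=
    {p | p.2 ∈ chamber (N + 1) ∧ p.1 ∈ gapBox p.2} with hS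
  have hSm : MeasurableSet S := by
    refine MeasurableSet.inter (measurable_snd (measurableSet_chamber (N + 1))) ?_
    have h : {p : (Fin N → ℝ) × (Fin (N + 1) → ℝ) | p.1 ∈ gapBox p.2} =
        ⋂ i : Fin N, {p | p.2 i.castSucc < p.1 i} ∩ {p | p.1 i < p.2 i.succ} := by
      ext p
      simp [gapBox]
    change MeasurableSet {p : (Fin N → ℝ) × (Fin (N + 1) → ℝ) | p.1 ∈ gapBox p.2}
    rw [h]
    exact MeasurableSet.iInter fun i => MeasurableSet.inter
      (measurableSet_lt (by fun_prop) (by fun_prop)) (measurableSet_lt (by fun_prop) (by fun_prop))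
  -- Encoding the coupled domain as an indicator on the product space lets Tonelli exchange the
  -- integrals.
  set G : (Fin N → ℝ) × (Fin (N + 1) → ℝ) → ENNReal := S.indicator fun p =>
    f p.2 * ENNReal.ofReal (updateKernel m p.1 p.2) with hG
  have hGm : Measurable G := by
    have := measurable_updateKernel (N := N) m
    exact Measurable.indicator (by fun_prop) hSm
  have hJm : Measurable fun a => ∫⁻ x, G (a, x) := hGm.lintegral_prod_right'
  have hcont : Continuous fun Y : Fin (N + 1) → Fin (N + m + 1) → ℂ => wishart b (ofColumns Y) :=
    continuous_wishart_ofColumns b continuous_id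
  have hcontN : Continuous fun Y : Fin N → Fin (N + m + 1) → ℂ => wishart b (ofColumns Y) :=
    continuous_wishart_ofColumns b continuous_id
  have hevm := measurable_sortedEigenvalues hcontN
  -- Testing `ih` on the indicator of the complement shows that the old spectrum is almost surely
  -- positive and simple, as `lintegral_update` requires.
  have hae : ∀ᵐ Y ∂(Measure.pi fun _ : Fin N => gaussianVector (N + m + 1)),
      sortedEigenvalues (wishart b (ofColumns Y)) ∈ chamber N := by
    have h := ih ((chamber N)ᶜ.indicator 1) (measurable_one.indicator (measurableSet_chamber N).compl)
    have h0 : ∫⁻ x in chamber N, (chamber N)ᶜ.indicator 1 x *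
        ENNReal.ofReal (K * detForm (N + m + 1) N b x) = 0 := by
      rw [← lintegral_zero (μ := volume.restrict (chamber N))]
      refine setLIntegral_congr_fun (measurableSet_chamber N) fun x hx => ?_
      simp [hx]
    rw [h0] at h
    have h' := (lintegral_eq_zero_iff (f := fun Y : Fin N → Fin (N + m + 1) → ℂ =>
      (chamber N)ᶜ.indicator (1 : (Fin N → ℝ) → ENNReal) (sortedEigenvalues
        (wishart b (ofColumns Y)))) ((measurable_one.indicator
          (measurableSet_chamber N).compl).comp hevm)).1 h
    filter_upwards [h'] with Y hY
    by_contra hn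
    simp [hn] at hY
  have hsnocm : Continuous fun p : (Fin N → Fin (N + m + 1) → ℂ) × (Fin (N + m + 1) → ℂ) =>
      (Fin.snoc p.1 p.2 : Fin (N + 1) → Fin (N + m + 1) → ℂ) :=
    Continuous.finSnoc (A := fun _ : Fin (N + 1) => Fin (N + m + 1) → ℂ)
      continuous_fst continuous_snd
  have hFm : Measurable fun p : (Fin N → Fin (N + m + 1) → ℂ) × (Fin (N + m + 1) → ℂ) =>
      f (sortedEigenvalues (wishart b (ofColumns
        (Fin.snoc p.1 p.2 : Fin (N + 1) → Fin (N + m + 1) → ℂ)))) :=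
    hf.comp (measurable_sortedEigenvalues (hcont.comp hsnocm))
  have hdm := measurable_detForm (N + m + 1) N b
  calc _ = ∫⁻ Y : Fin N → Fin (N + m + 1) → ℂ, (∫⁻ v, f (sortedEigenvalues (wishart b (ofColumns
          (Fin.snoc Y v : Fin (N + 1) → Fin (N + m + 1) → ℂ)))) ∂gaussianVector (N + m + 1))
            ∂(Measure.pi fun _ => gaussianVector (N + m + 1)) := by
        rw [lintegral_pi_insertNth (F := fun Y : Fin (N + 1) → Fin (N + m + 1) → ℂ =>
          f (sortedEigenvalues (wishart b (ofColumns Y)))) _ (Fin.last N)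
          (hf.comp (measurable_sortedEigenvalues hcont))]
        simp_rw [Fin.insertNth_last']
        exact lintegral_lintegral_swap (hFm.comp measurable_swap).aemeasurable
    _ = ∫⁻ Y : Fin N → Fin (N + m + 1) → ℂ,
          (∫⁻ x, G (sortedEigenvalues (wishart b (ofColumns Y)), x))
            ∂(Measure.pi fun _ => gaussianVector (N + m + 1)) := by
        refine lintegral_congr_ae ?_
        filter_upwards [hae] with Y hY
        rw [lintegral_update rfl hN hb Y rfl hY hf,
          ← lintegral_indicator (measurableSet_interlacing _)]
        refine lintegral_congr fun x => ?_
        by_cases hx : x ∈ interlacing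
            (Fin.cons 0 (sortedEigenvalues (wishart b (ofColumns Y))) : Fin (N + 1) → ℝ)
        · rw [Set.indicator_of_mem hx, hG, Set.indicator_of_mem]
          exact mem_chamber_and_mem_interlacing_iff.1 ⟨hY, hx⟩
        · rw [Set.indicator_of_notMem hx, hG, Set.indicator_of_notMem]
          exact fun h => hx (mem_chamber_and_mem_interlacing_iff.2 h).2
    _ = ∫⁻ a in chamber N, (∫⁻ x, G (a, x)) *
          ENNReal.ofReal (K * detForm (N + m + 1) N b a) := ih _ hJm
    _ = ∫⁻ x, ∫⁻ a in chamber N, G (a, x) *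
          ENNReal.ofReal (K * detForm (N + m + 1) N b a) := by
        rw [← lintegral_lintegral_swap (by fun_prop)]
        refine lintegral_congr fun a => ?_
        rw [lintegral_mul_const _ (by fun_prop)]
    _ = _ := by
        rw [← lintegral_indicator (measurableSet_chamber (N + 1))]
        refine lintegral_congr fun x => ?_
        by_cases hx : x ∈ chamber (N + 1)
        · rw [Set.indicator_of_mem hx, hval x hx, ENNReal.ofReal_mul
            (div_nonneg (laguerreWeight_pos m hx).le hfac.le), ofReal_integral_eq_lintegral_ofReal
            (integrableOn_gapBox x ((continuous_det_borderedVandermonde c).const_mul K))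
            ((ae_restrict_iff' (hgapm x)).2 (Filter.Eventually.of_forall fun a ha =>
              hB0 a (hgap x hx a ha)))]
          have hBm : Measurable fun a : Fin N → ℝ =>
              ENNReal.ofReal (K * (borderedVandermonde c a).det) :=
            ((continuous_det_borderedVandermonde c).measurable.const_mul K).ennreal_ofReal
          rw [← lintegral_const_mul _ hBm, ← lintegral_const_mul _ (hBm.const_mul _),
            ← lintegral_indicator (measurableSet_chamber N), ← lintegral_indicator (hgapm x)]
          refine lintegral_congr fun a => ?_
          by_cases ha : a ∈ gapBox x
          · have hac := hgap x hx a ha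
            have hk0 : 0 ≤ updateKernel m a x := by
              have h := updateKernel_mul_laguerreWeight m hac x
              have h1 := laguerreWeight_pos (m + 1) hac
              have h2 : 0 ≤ updateKernel m a x * laguerreWeight (m + 1) a := by
                rw [h]
                exact div_nonneg (laguerreWeight_pos m hx).le hfac.le
              exact nonneg_of_mul_nonneg_left h2 h1
            -- Kernel and old weight combine into a factor depending on `x` alone.
            rw [Set.indicator_of_mem hac, Set.indicator_of_mem ha, hG,
              Set.indicator_of_mem (show (a, x) ∈ S from ⟨hx, ha⟩), mul_assoc,
              ← ENNReal.ofReal_mul hk0, ← ENNReal.ofReal_mul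
                (div_nonneg (laguerreWeight_pos m hx).le hfac.le), hform,
              ← updateKernel_mul_laguerreWeight m hac x]
            congr 2
            ring
          · rw [Set.indicator_of_notMem ha]
            by_cases hac : a ∈ chamber N
            · rw [Set.indicator_of_mem hac, hG, Set.indicator_of_notMem fun h => ha h.2, zero_mul]
            · rw [Set.indicator_of_notMem hac]
        · rw [Set.indicator_of_notMem hx]
          have : ∀ a, G (a, x) = 0 := fun a => Set.indicator_of_notMem (fun h => hx h.1) _
          simp [this]

/-- The joint density of the increasing eigenvalues of the spiked Wishart matrix. -/
theorem lintegral_sortedEigenvalues {n N : ℕ} (hN : 1 ≤ N) (hNn : N ≤ n) {b : ℝ} (hb : 0 < b)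
    (hb1 : b ≠ 1 ∨ N = 1) :
    ∃ K : ℝ, K ≠ 0 ∧ (∀ x ∈ chamber N, 0 ≤ K * detForm n N b x) ∧
      ∀ f : (Fin N → ℝ) → ENNReal, Measurable f →
        ∫⁻ Y, f (sortedEigenvalues (wishart b (ofColumns Y)))
          ∂(Measure.pi fun _ : Fin N => gaussianVector n) =
        ∫⁻ x in chamber N, f x * ENNReal.ofReal (K * detForm n N b x) := by
  rcases hb1 with hb1 | rfl
  · induction N, hN using Nat.le_induction with
    | base => exact lintegral_sortedEigenvalues_one hNn hb
    | succ N hN ih =>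
      obtain ⟨K, hK, hK0, h⟩ := ih (by omega)
      exact lintegral_sortedEigenvalues_succ hN hNn hb hb1 hK hK0 h
  · exact lintegral_sortedEigenvalues_one hNn hb

end

/-! ### From ordered to unordered eigenvalues -/

theorem detForm_comp_perm (n N : ℕ) (b : ℝ) (x : Fin N → ℝ) (σ : Equiv.Perm (Fin N)) :
    detForm n N b (x ∘ σ) = detForm n N b x := by
  have h1 : diffProd (x ∘ σ) = ((Equiv.Perm.sign σ : ℤ) : ℝ) * diffProd x := by
    rw [diffProd_eq_det_vandermonde, diffProd_eq_det_vandermonde, ← Matrix.det_permute]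
    rfl
  have h2 : (borderedVandermonde (1 - 1 / b) (x ∘ σ)).det =
      ((Equiv.Perm.sign σ : ℤ) : ℝ) * (borderedVandermonde (1 - 1 / b) x).det := by
    rw [← Matrix.det_permute]
    rfl
  have h3 : ∏ l, (x ∘ σ) l ^ (n - N) * Real.exp (-(x ∘ σ) l) =
      ∏ l, x l ^ (n - N) * Real.exp (-x l) :=
    Equiv.prod_comp σ fun l => x l ^ (n - N) * Real.exp (-x l)
  have h4 : ((Equiv.Perm.sign σ : ℤ) : ℝ) * ((Equiv.Perm.sign σ : ℤ) : ℝ) = 1 := by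
    rcases Int.units_eq_one_or (Equiv.Perm.sign σ) with h | h <;> simp [h]
  rw [detForm, detForm, h1, h2, h3]
  linear_combination (∏ l, x l ^ (n - N) * Real.exp (-x l)) * diffProd x *
    (borderedVandermonde (1 - 1 / b) x).det * h4

theorem detForm_eq_zero_of_not_injective (n : ℕ) {N : ℕ} (b : ℝ) {x : Fin N → ℝ}
    (hx : ¬ Function.Injective x) : detForm n N b x = 0 := by
  have h : diffProd x = 0 := not_not.1 fun h => hx (diffProd_ne_zero_iff.1 h)
  simp [detForm, h]

theorem exists_comp_perm_mem_chamber {N : ℕ} {x : Fin N → ℝ} (hx : ∀ l, 0 < x l)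
    (hinj : Function.Injective x) : ∃ σ : Equiv.Perm (Fin N), x ∘ σ ∈ chamber N :=
  ⟨Tuple.sort x, fun _ => hx _, (Tuple.monotone_sort x).strictMono_of_injective
    (hinj.comp (Tuple.sort x).injective)⟩

theorem eq_of_comp_perm_mem_chamber {N : ℕ} {x : Fin N → ℝ} {σ τ : Equiv.Perm (Fin N)}
    (hσ : x ∘ σ ∈ chamber N) (hτ : x ∘ τ ∈ chamber N) : σ = τ := by
  have h : x ∘ σ = x ∘ τ := Tuple.unique_monotone hσ.2.monotone hτ.2.monotone
  have hinj : Function.Injective x := by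
    have := hσ.2.injective.comp σ.symm.injective
    simpa [Function.comp_assoc] using this
  exact Equiv.ext fun i => hinj (congrFun h i)

theorem nonneg_of_nonneg_on_chamber {n N : ℕ} {b K : ℝ}
    (hK : ∀ x ∈ chamber N, 0 ≤ K * detForm n N b x) {x : Fin N → ℝ} (hx : ∀ l, 0 < x l) :
    0 ≤ K * detForm n N b x := by
  by_cases hinj : Function.Injective x
  · obtain ⟨σ, hσ⟩ := exists_comp_perm_mem_chamber hx hinj
    rw [← detForm_comp_perm n N b x σ]
    exact hK _ hσ
  · simp [detForm_eq_zero_of_not_injective n b hinj]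

/-- Exactly one permutation sorts a positive vector with distinct entries; with repeated entries
both sides vanish. -/
theorem sum_indicator_chamber {n N : ℕ} {b : ℝ} (K : ℝ) (x : Fin N → ℝ) :
    ∑ σ : Equiv.Perm (Fin N), (chamber N).indicator
        (fun y => ENNReal.ofReal (K * detForm n N b y)) (x ∘ σ) =
      ENNReal.ofReal (onPositive (fun x => K * detForm n N b x) x) := by
  by_cases hx : x ∈ {x : Fin N → ℝ | ∀ l, 0 < x l}
  · rw [onPositive, Set.indicator_of_mem hx]
    by_cases hinj : Function.Injective x
    · obtain ⟨σ, hσ⟩ := exists_comp_perm_mem_chamber hx hinj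
      rw [Finset.sum_eq_single σ, Set.indicator_of_mem hσ, detForm_comp_perm]
      · intro τ _ hτ
        exact Set.indicator_of_notMem (fun h => hτ (eq_of_comp_perm_mem_chamber h hσ)) _
      · simp
    · rw [detForm_eq_zero_of_not_injective n b hinj]
      simp only [mul_zero, ENNReal.ofReal_zero]
      refine Finset.sum_eq_zero fun σ _ => ?_
      simp [Set.indicator, detForm_comp_perm, detForm_eq_zero_of_not_injective n b hinj]
  · rw [onPositive, Set.indicator_of_notMem hx, ENNReal.ofReal_zero]
    refine Finset.sum_eq_zero fun σ _ => Set.indicator_of_notMem (fun h => hx fun l => ?_) _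
    simpa using h.1 (σ.symm l)

theorem lintegral_comp_perm {N : ℕ} (σ : Equiv.Perm (Fin N)) (f : (Fin N → ℝ) → ENNReal) :
    ∫⁻ x, f (x ∘ σ) = ∫⁻ x, f x := by
  have h := (volume_measurePreserving_piCongrLeft (fun _ : Fin N => ℝ) σ.symm).lintegral_comp_emb
    (MeasurableEquiv.measurableEmbedding _) f
  rw [← h]
  refine lintegral_congr fun x => congrArg f (funext fun i => ?_)
  have := MeasurableEquiv.piCongrLeft_apply_apply (β := fun _ : Fin N => ℝ) σ.symm x (σ i)
  simpa using this.symm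

theorem sum_lintegral_chamber {n N : ℕ} (b K : ℝ) {s : Set (Fin N → ℝ)} (hs : MeasurableSet s) :
    ∑ σ : Equiv.Perm (Fin N), ∫⁻ x in chamber N, s.indicator 1 (x ∘ σ) *
        ENNReal.ofReal (K * detForm n N b x) =
      ∫⁻ x in s, ENNReal.ofReal (onPositive (fun x => K * detForm n N b x) x) := by
  have hd := measurable_detForm n N b
  have hg : Measurable ((chamber N).indicator fun y => ENNReal.ofReal (K * detForm n N b y)) :=
    Measurable.indicator (by fun_prop) (measurableSet_chamber N)
  have h1 : ∀ σ : Equiv.Perm (Fin N), ∫⁻ x in chamber N, s.indicator 1 (x ∘ σ) *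
        ENNReal.ofReal (K * detForm n N b x) =
      ∫⁻ x, s.indicator 1 x * (chamber N).indicator
        (fun y => ENNReal.ofReal (K * detForm n N b y)) (x ∘ σ.symm) := by
    intro σ
    rw [← lintegral_comp_perm σ, ← lintegral_indicator (measurableSet_chamber N)]
    refine lintegral_congr fun x => ?_
    have : (x ∘ σ) ∘ σ.symm = x := by simp [Function.comp_assoc]
    rw [this]
    by_cases hx : x ∈ chamber N <;> simp [hx]
  simp_rw [h1]
  rw [← lintegral_finsetSum, ← lintegral_indicator hs]
  · refine lintegral_congr fun x => ?_
    have h2 := Equiv.sum_comp (Equiv.inv (Equiv.Perm (Fin N))) fun σ : Equiv.Perm (Fin N) =>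
        (chamber N).indicator (fun y => ENNReal.ofReal (K * detForm n N b y)) (x ∘ σ)
    rw [sum_indicator_chamber] at h2
    rw [← Finset.mul_sum, show ∑ σ : Equiv.Perm (Fin N), (chamber N).indicator
      (fun y => ENNReal.ofReal (K * detForm n N b y)) (x ∘ σ.symm) = _ from h2]
    by_cases hx : x ∈ s <;> simp [hx]
  · intro σ _
    exact (measurable_one.indicator hs).mul (hg.comp (by fun_prop))

/-! ### Transfer to the random matrix -/

theorem IsStdComplexGaussianMatrix.exists_columns {n N : ℕ} {Ω : Type*} [MeasurableSpace Ω]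
    {P : Measure Ω} [IsProbabilityMeasure P] {X : Ω → Matrix (Fin n) (Fin N) ℂ}
    (h : IsStdComplexGaussianMatrix P X) :
    ∃ Z : Ω → Fin N → Fin n → ℂ, AEMeasurable Z P ∧
      P.map Z = (Measure.pi fun _ : Fin N => gaussianVector n) ∧ ∀ ω, X ω = ofColumns (Z ω) := by
  have hm : ∀ p : Fin N × Fin n, AEMeasurable (fun ω => X ω p.2 p.1) P :=
    fun p => (h.hasLaw p.2 p.1).aemeasurable
  have hind : iIndepFun (fun (p : Fin N × Fin n) ω => X ω p.2 p.1) P :=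
    h.indep.precomp (g := Prod.swap) Prod.swap_injective
  have hlaw := (iIndepFun_iff_map_fun_eq_pi_map hm).1 hind
  have hpi : (fun p : Fin N × Fin n => P.map fun ω => X ω p.2 p.1) =
      fun _ => stdComplexGaussian := funext fun p => (h.hasLaw p.2 p.1).map_eq
  rw [hpi] at hlaw
  have hmp : AEMeasurable (fun ω (p : Fin N × Fin n) => X ω p.2 p.1) P := aemeasurable_pi_lambda _ hm
  have hc := (MeasurableEquiv.curry (Fin N) (Fin n) ℂ).measurable
  refine ⟨fun ω k i => X ω i k, hc.comp_aemeasurable hmp, ?_, fun ω => rfl⟩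
  -- Independence gives a product law indexed by pairs, column index first; currying groups it into
  -- independent Gaussian columns.
  have hcur := Measure.infinitePi_map_curry
    (fun (_ : Fin N) (_ : Fin n) => stdComplexGaussian)
  simp only [Measure.infinitePi_eq_pi] at hcur
  rw [← hlaw, AEMeasurable.map_map_of_aemeasurable hc.aemeasurable hmp] at hcur
  exact hcur

theorem isEigenvaluePDF_wishart {n N : ℕ} {b K : ℝ} {Ω : Type*} [MeasurableSpace Ω]
    {P : Measure Ω} [IsProbabilityMeasure P] {X : Ω → Matrix (Fin n) (Fin N) ℂ}
    (hX : IsStdComplexGaussianMatrix P X)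
    (hK : ∀ x ∈ chamber N, 0 ≤ K * detForm n N b x)
    (hlaw : ∀ f : (Fin N → ℝ) → ENNReal, Measurable f →
      ∫⁻ Y, f (sortedEigenvalues (wishart b (ofColumns Y)))
        ∂(Measure.pi fun _ : Fin N => gaussianVector n) =
      ∫⁻ x in chamber N, f x * ENNReal.ofReal (K * detForm n N b x)) :
    IsEigenvaluePDF P (fun ω => wishart b (X ω)) (fun ω => wishart_isHermitian b (X ω))
      (onPositive fun x => K / N.factorial * detForm n N b x) := by
  have hfac : (0 : ℝ) < N.factorial := by exact_mod_cast Nat.factorial_pos N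
  have hd := measurable_detForm n N b
  have hpos : MeasurableSet {x : Fin N → ℝ | ∀ l, 0 < x l} := by measurability
  have hK' : ∀ x : Fin N → ℝ, K / N.factorial * detForm n N b x =
      (N.factorial : ℝ)⁻¹ * (K * detForm n N b x) := fun x => by ring
  obtain ⟨ρ, hρ⟩ := exists_perm_eigenvalues_eq N
  obtain ⟨Z, hZ, hZlaw, hXZ⟩ := hX.exists_columns
  have hev : Measurable fun Y : Fin N → Fin n → ℂ =>
      sortedEigenvalues (wishart b (ofColumns Y)) :=
    measurable_sortedEigenvalues (continuous_wishart_ofColumns b continuous_id)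
  have heig : ∀ ω, (wishart_isHermitian b (X ω)).eigenvalues =
      sortedEigenvalues (wishart b (ofColumns (Z ω))) ∘ ρ := fun ω => by
    rw [← hXZ]
    exact hρ _ _
  have hcomp : ∀ σ : Equiv.Perm (Fin N), Measurable fun x : Fin N → ℝ => x ∘ σ := fun σ => by
    fun_prop
  have haem : AEMeasurable (fun ω => (wishart_isHermitian b (X ω)).eigenvalues) P := by
    simp_rw [heig]
    exact ((hcomp ρ).comp hev).comp_aemeasurable hZ
  refine ⟨Measurable.indicator (by fun_prop) hpos, ?_, ?_, haem, ?_⟩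
  · refine Set.indicator_nonneg fun x hx => ?_
    rw [hK']
    exact mul_nonneg (inv_nonneg.2 hfac.le) (nonneg_of_nonneg_on_chamber hK hx)
  · intro σ x
    have : (∀ l, 0 < (x ∘ σ) l) ↔ ∀ l, 0 < x l := 
      ⟨fun h l => by simpa using h (σ.symm l), fun h l => h _⟩
    simp only [onPositive, Set.indicator, Set.mem_ofPred_eq, this, detForm_comp_perm]
  · ext s hs
    have h1 : ∀ σ : Equiv.Perm (Fin N),
        P.map (fun ω => (wishart_isHermitian b (X ω)).eigenvalues ∘ σ) s =
          ∫⁻ x in chamber N, s.indicator 1 (x ∘ ⇑(ρ * σ)) *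
            ENNReal.ofReal (K * detForm n N b x) := by
      intro σ
      have hS : Measurable fun x : Fin N → ℝ => s.indicator (1 : (Fin N → ℝ) → ENNReal) (x ∘ ⇑(ρ * σ)) :=
        (measurable_one.indicator hs).comp (hcomp (ρ * σ))
      rw [← hlaw _ hS, ← hZlaw, lintegral_map' (f := fun Y : Fin N → Fin n → ℂ =>
          s.indicator (1 : (Fin N → ℝ) → ENNReal)
            (sortedEigenvalues (wishart b (ofColumns Y)) ∘ ⇑(ρ * σ)))
          (hS.comp hev).aemeasurable hZ,
        ← lintegral_indicator_one hs, lintegral_map' (measurable_one.indicator hs).aemeasurable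
          (g := fun ω => (wishart_isHermitian b (X ω)).eigenvalues ∘ σ)
          ((hcomp σ).comp_aemeasurable haem)]
      refine lintegral_congr fun ω => ?_
      rw [heig]
      rfl
    rw [Measure.smul_apply, Measure.finsetSum_apply, withDensity_apply _ hs, smul_eq_mul]
    -- The average runs over all permutations, so the fixed rearrangement `ρ` is absorbed by `σ ↦ ρ
    -- * σ`.
    have h2 := Equiv.sum_comp (Equiv.mulLeft ρ) fun τ : Equiv.Perm (Fin N) =>
      ∫⁻ x in chamber N, s.indicator 1 (x ∘ τ) * ENNReal.ofReal (K * detForm n N b x)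
    simp only [Equiv.coe_mulLeft] at h2
    simp_rw [h1]
    rw [h2, sum_lintegral_chamber b K hs, ← lintegral_const_mul' _ _ (by simp [Nat.factorial_ne_zero])]
    refine lintegral_congr fun x => ?_
    by_cases hx : ∀ l, 0 < x l
    · simp only [onPositive, Set.indicator, Set.mem_ofPred_eq, hx, implies_true, if_true]
      rw [hK', ENNReal.ofReal_mul (inv_nonneg.2 hfac.le), ENNReal.ofReal_inv_of_pos hfac,
        ENNReal.ofReal_natCast]
    · simp [onPositive, Set.indicator, hx]

end SpikedWishart

end

open SpikedWishart in
theorem proposition3p2 (n N : ℕ) (hN : 1 ≤ N) (hNn : N ≤ n) (b : ℝ) (hb : 0 < b)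
    (hb1 : b ≠ 1 ∨ N = 1) :
    (∃ C : ℝ, C ≠ 0 ∧ ∀ x : Fin N → ℝ, (∀ l, 0 < x l) →
      haarForm n N b x = C * detForm n N b x) ∧
    ∃ K : ℝ, K ≠ 0 ∧ ∀ (Ω : Type*) [MeasurableSpace Ω] (P : MeasureTheory.Measure Ω)
      [MeasureTheory.IsProbabilityMeasure P] (X : Ω → Matrix (Fin n) (Fin N) ℂ),
      IsStdComplexGaussianMatrix P X →
        IsEigenvaluePDF P (fun ω => wishart b (X ω)) (fun ω => wishart_isHermitian b (X ω))
          (onPositive fun x => K * detForm n N b x) := by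
  refine ⟨⟨haarCoeff N b, haarCoeff_ne_zero hb hb1, fun x _ => haarForm_eq n hN hb hb1 x⟩, ?_⟩
  obtain ⟨K, hK, hK0, hlaw⟩ := lintegral_sortedEigenvalues hN hNn hb hb1
  -- `K` normalises on the ordered chamber; a uniformly random order spreads the mass over `N!`
  -- copies of it.
  refine ⟨K / N.factorial, div_ne_zero hK (by exact_mod_cast Nat.factorial_ne_zero N), ?_⟩
  intro Ω _ P _ X hX
  exact isEigenvaluePDF_wishart hX hK0 hlaw
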